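/- **Setting.** A game $G=(N,w)$ is a complete undirected graph on a finite set $N$ of agents with weights $w\colon\binom N2\to\mathbb Q$. The social welfare of a partition $\pi$ of $N$ into coalitions is $\mathcal{SW}(\pi)=\sum_{C\in\pi}\sum_{i\in C}\sum_{j\in C\setminus\{i\}}w(\{i,j\})$, and $\pi^*(G)$ denotes a partition of maximum welfare. The agents arrive one by one in an order $\sigma$; a deterministic online algorithm must irrevocably place each arriving agent in an existing coalition or in a new singleton coalition, knowing only the order of arrival so far and the game restricted to the agents present. For an online algorithm $\mathit{ALG}$ with output $\mathit{ALG}(G,\sigma)$, its competitive ratio under random arrival on games with $n$ agents is $$c_{\mathit{ALG}}(n)=\inf_{G=(N,w),\ |N|=n}\ \frac{\mathbb E_\sigma[\mathcal{SW}(\mathit{ALG}(G,\sigma))]}{\mathcal{SW}(\pi^*(G))},$$ where $\sigma$ is a uniformly random order of $N$, with the conventions $\frac00=1$ and $\frac x0=0$ for $x<0$ (equivalently, $c_{\mathit{ALG}}(n)$ is the supremum of all $c$ such that this infimum is at least $c$). For a known even number $m$ of agents, the waiting greedy algorithm $\mathit{WGDY}$ places the first $m/2$ arriving agents in singleton coalitions;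 it then assigns each later agent greedily: if some available partition has larger welfare than the current one, it chooses an available partition of maximum welfare (ties broken by an arbitrary rule), and otherwise it puts the agent in a singleton coalition. The iterated waiting algorithm $\mathit{IWA}$ does not know the number of agents. It works in phases $i=0,1,2,\dots$, where phase $i$ consists of the next $2^{i+1}$ arriving agents; to the agents of phase $i$ (of which there may be fewer in the last phase) it applies $\mathit{WGDY}$ with $m=2^{i+1}$, and its partition is the union of the partitions formed in the phases. **Theorem.** The iterated waiting algorithm has competitive ratio $c_{\mathit{IWA}}(n)=\Theta(1/n)$ under random arrival: there are absolute constants $c,C>0$, independent of the tie-breaking, such that for all $n\ge 1$ $$\frac cn\ \le\ c_{\mathit{IWA}}(n)\ \le\ \frac Cn .$$ -/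

import Mathlib

namespace OnlineCoalition

universe u

variable {α : Type u} [DecidableEq α]

/-! ### Additively separable hedonic games -/

/-- A complete undirected weighted graph on a finite set of agents taken from the pool `α`.
Only the weights `weight s(i, j)` of distinct agents `i, j ∈ agents` are ever used. -/
structure Game (α : Type u) where
  agents : Finset α
  weight : Sym2 α → ℚ

/-- `π` is a partition of `S` into nonempty coalitions. -/
def IsPartition (S : Finset α) (π : Finset (Finset α)) : Prop :=
  ∃ P : Finpartition S, P.parts = π

/-- The utility of agent `i` for the coalition `C`. -/
def utility (w : Sym2 α → ℚ) (i : α) (C : Finset α) : ℚ :=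
  ∑ j ∈ C.erase i, w s(i, j)

/-- The (utilitarian) social welfare of the partition `π`. -/
def socialWelfare (w : Sym2 α → ℚ) (π : Finset (Finset α)) : ℚ :=
  ∑ C ∈ π, ∑ i ∈ C, utility w i C

/-- The social welfare of a welfare-optimal partition of `G`. -/
def optWelfare (G : Game α) : ℚ :=
  (Finset.univ : Finset (Finpartition G.agents)).sup' Finset.univ_nonempty
    fun P => socialWelfare G.weight P.parts

/-! ### Online coalition formation -/

/-- `π - x`: the partition `π` restricted to the agents other than `x`. -/
def removeAgent (π : Finset (Finset α)) (x : α) : Finset (Finset α) :=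
  (π.image fun C => C.erase x).erase ∅

/-- The partitions available when the current partition is `π` and `x` arrives: the partitions
`π'` of the present agents with `π' - x = π`. -/
def available (π : Finset (Finset α)) (x : α) : Set (Finset (Finset α)) :=
  {π' | IsPartition (insert x (π.biUnion id)) π' ∧ removeAgent π' x = π}

/-- A deterministic online coalition formation algorithm. `out l w` is its partition once exactly
the agents of the list `l` have arrived, in this order, the edge weights being `w`. By `locality` it
depends only on the game restricted to the present agents. -/
structure OnlineAlgorithm (α : Type u) [DecidableEq α] where
  out : List α → (Sym2 α → ℚ) → Finset (Finset α)
  locality : ∀ (l : List α) (w w' : Sym2 α → ℚ), l.Nodup →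
    (∀ x ∈ l, ∀ y ∈ l, x ≠ y → w s(x, y) = w' s(x, y)) → out l w = out l w'
  isPartition : ∀ (l : List α) (w : Sym2 α → ℚ), l.Nodup → IsPartition l.toFinset (out l w)
  mem_available : ∀ (l : List α) (x : α) (w : Sym2 α → ℚ), (l ++ [x]).Nodup →
    out (l ++ [x]) w ∈ available (out l w) x

/-- `π'` is a possible greedy choice when the current partition is `π` and `x` arrives: if some
available partition has larger welfare than `π`, then `π'` is an available partition of maximum
welfare (ties may be broken in any way); otherwise `x` forms a singleton coalition. -/
def IsGreedyStep (w : Sym2 α → ℚ) (π : Finset (Finset α)) (x : α) (π' : Finset (Finset α)) :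
    Prop :=
  ((∃ ρ ∈ available π x, socialWelfare w π < socialWelfare w ρ) →
    π' ∈ available π x ∧ ∀ ρ ∈ available π x, socialWelfare w ρ ≤ socialWelfare w π') ∧
  ((¬ ∃ ρ ∈ available π x, socialWelfare w π < socialWelfare w ρ) → π' = insert {x} π)

/-- `W` is the waiting greedy algorithm for a known and even number of agents; `W n` is the
algorithm that is told the number `n`. The first `n / 2` agents are put in singleton
coalitions, the remaining ones are assigned greedily (with any tie-breaking). -/
def IsWaitingGreedy (W : ℕ → OnlineAlgorithm α) : Prop :=
  ∀ n : ℕ, Even n → ∀ (l : List α) (x : α) (w : Sym2 α → ℚ), (l ++ [x]).Nodup → l.length < n →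
    (l.length < n / 2 → (W n).out (l ++ [x]) w = insert {x} ((W n).out l w)) ∧
    (n / 2 ≤ l.length → IsGreedyStep w ((W n).out l w) x ((W n).out (l ++ [x]) w))

/-- The agents of the list `l` that arrive in the `i`th phase, in order of arrival: phase `i`
consists of the `2 ^ (i + 1)` agents after the first
`2 ^ 1 + ... + 2 ^ i = 2 ^ (i + 1) - 2` ones. -/
def phase (i : ℕ) (l : List α) : List α :=
  (l.drop (2 ^ (i + 1) - 2)).take (2 ^ (i + 1))

/-- The partition formed by the iterated doubling variant of `A`: in the `i`th phase, `A` is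
applied to the agents of this phase, being told that their number is `2 ^ (i + 1)`. Phases with
index at least `l.length` are empty. -/
def doublingOut (A : ℕ → OnlineAlgorithm α) (l : List α) (w : Sym2 α → ℚ) :
    Finset (Finset α) :=
  (Finset.range l.length).biUnion fun i => (A (2 ^ (i + 1))).out (phase i l) w

/-! ### Competitive analysis under random arrival -/

/-- The order `σ` as the list of the agents in order of arrival. -/
def arrivalList (N : Finset α) (σ : Fin N.card ≃ N) : List α :=
  List.ofFn fun i => (σ i : α)

/-- The expected social welfare of the output of `A` on `G`, the arrival order being uniformly
distributed among all orders of the agents. -/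
def expectedWelfare (A : OnlineAlgorithm α) (G : Game α) : ℚ :=
  (∑ σ : Fin G.agents.card ≃ G.agents,
    socialWelfare G.weight (A.out (arrivalList G.agents σ) G.weight)) /
      (Fintype.card (Fin G.agents.card ≃ G.agents) : ℚ)

/-- The quotient `p / q`, with the conventions `0 / 0 = 1` and `p / 0 = 0` for `p ≠ 0`. -/
def welfareRatio (p q : ℚ) : ℚ :=
  if q = 0 then (if p = 0 then 1 else 0) else p / q

/-- `A` is `c`-competitive under random arrival on games with `n` agents. -/
def IsCompetitive (A : OnlineAlgorithm α) (n : ℕ) (c : ℝ) : Prop :=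
  (c : EReal) ≤ ⨅ (G : Game α) (_ : G.agents.card = n),
    (((welfareRatio (expectedWelfare A G) (optWelfare G) : ℚ) : ℝ) : EReal)

/-- The competitive ratio of `A` under random arrival, as a function of the number `n` of agents:
the supremum of all `c` such that `A` is `c`-competitive. -/
noncomputable def competitiveRatio (A : OnlineAlgorithm α) (n : ℕ) : EReal :=
  ⨆ (c : ℝ) (_ : IsCompetitive A n c), (c : EReal)

/-! ### The iterated doubling variant is an online algorithm -/

theorem isPartition_iff (S : Finset α) (π : Finset (Finset α)) :
    IsPartition S π ↔
      ∅ ∉ π ∧ (∀ C ∈ π, ∀ D ∈ π, ∀ a, a ∈ C → a ∈ D → C = D) ∧ π.biUnion id = S := by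
  constructor
  · rintro ⟨P, rfl⟩
    exact ⟨P.empty_notMem_parts, fun C hC D hD a h1 h2 => P.eq_of_mem_parts hC hD h1 h2,
      P.biUnion_parts⟩
  · rintro ⟨h0, h1, rfl⟩
    refine ⟨Finpartition.ofExistsUnique π ?_ ?_ h0, rfl⟩
    · intro p hp a ha
      exact Finset.mem_biUnion.2 ⟨p, hp, ha⟩
    · intro a ha
      obtain ⟨C, hC, haC⟩ := Finset.mem_biUnion.1 ha
      exact ⟨C, ⟨hC, haC⟩, fun D hD => h1 D hD.1 C hC a hD.2 haC⟩

theorem IsPartition.support {S : Finset α} {π : Finset (Finset α)} (h : IsPartition S π) :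
    π.biUnion id = S := ((isPartition_iff S π).1 h).2.2

theorem removeAgent_of_notMem {S : Finset α} {π : Finset (Finset α)} (h : IsPartition S π)
    {x : α} (hx : x ∉ S) : removeAgent π x = π := by
  obtain ⟨h0, -, h2⟩ := (isPartition_iff S π).1 h
  have h3 : ∀ C ∈ π, C.erase x = C := fun C hC =>
    Finset.erase_eq_of_notMem fun hxC => hx (h2 ▸ Finset.mem_biUnion.2 ⟨C, hC, hxC⟩)
  unfold removeAgent
  rw [Finset.image_congr (g := id) (fun C hC => h3 C hC), Finset.image_id,
    Finset.erase_eq_of_notMem h0]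

theorem insert_singleton_mem_available {S : Finset α} {π : Finset (Finset α)}
    (h : IsPartition S π) {x : α} (hx : x ∉ S) : insert {x} π ∈ available π x := by
  have hr := removeAgent_of_notMem h hx
  obtain ⟨h0, h1, h2⟩ := (isPartition_iff S π).1 h
  have hxC : ∀ C ∈ π, x ∉ C := fun C hC hxC => hx (h2 ▸ Finset.mem_biUnion.2 ⟨C, hC, hxC⟩)
  refine ⟨(isPartition_iff _ _).2 ⟨?_, ?_, ?_⟩, ?_⟩
  · simp [h0]
  · intro C hC D hD a haC haD
    rw [Finset.mem_insert] at hC hD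
    rcases hC with rfl | hC <;> rcases hD with rfl | hD
    · rfl
    · rw [Finset.mem_singleton] at haC
      exact absurd (haC ▸ haD) (hxC D hD)
    · rw [Finset.mem_singleton] at haD
      exact absurd (haD ▸ haC) (hxC C hC)
    · exact h1 C hC D hD a haC haD
  · rw [Finset.biUnion_insert]
    rfl
  · unfold removeAgent at hr ⊢
    rw [Finset.image_insert]
    simp only [Finset.erase_singleton]
    rw [Finset.erase_insert_eq_erase, hr]

section Phases

variable {β : Type u}

theorem pow_phase (i : ℕ) : 2 ≤ 2 ^ (i + 1) := by
  have := Nat.one_le_two_pow (n := i)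
  rw [pow_succ]; omega

theorem phase_append_of_mem {l : List β} {x : β} {i : ℕ} (h1 : 2 ^ (i + 1) - 2 ≤ l.length)
    (h2 : l.length < 2 ^ (i + 2) - 2) : phase i (l ++ [x]) = phase i l ++ [x] := by
  have := pow_phase i
  have h3 : 2 ^ (i + 2) = 2 * 2 ^ (i + 1) := by ring
  unfold phase
  rw [List.drop_append_of_le_length h1, List.take_of_length_le, List.take_of_length_le]
  · simp only [List.length_drop]; omega
  · simp only [List.length_drop, List.length_append, List.length_singleton]; omega

theorem phase_append_of_notMem {l : List β} {x : β} {i : ℕ}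
    (h : ¬ (2 ^ (i + 1) - 2 ≤ l.length ∧ l.length < 2 ^ (i + 2) - 2)) :
    phase i (l ++ [x]) = phase i l := by
  have := pow_phase i
  have h3 : 2 ^ (i + 2) = 2 * 2 ^ (i + 1) := by ring
  unfold phase
  by_cases h1 : 2 ^ (i + 1) - 2 ≤ l.length
  · rw [List.drop_append_of_le_length h1, List.take_append_of_le_length]
    simp only [List.length_drop]; omega
  · rw [List.drop_eq_nil_of_le (by simp only [List.length_append, List.length_singleton]; omega),
      List.drop_eq_nil_of_le (by omega)]

theorem phase_unique {i j t : ℕ} (hi : 2 ^ (i + 1) - 2 ≤ t) (hi' : t < 2 ^ (i + 2) - 2)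
    (hj : 2 ^ (j + 1) - 2 ≤ t) (hj' : t < 2 ^ (j + 2) - 2) : i = j := by
  have key : ∀ a b : ℕ, a < b → 2 ^ (a + 2) ≤ 2 ^ (b + 1) := fun a b hab =>
    Nat.pow_le_pow_right (by norm_num) (by omega)
  rcases lt_trichotomy i j with h | h | h
  · have := key i j h; omega
  · exact h
  · have := key j i h; omega

theorem exists_phase (t : ℕ) : ∃ i, 2 ^ (i + 1) - 2 ≤ t ∧ t < 2 ^ (i + 2) - 2 := by
  induction t with
  | zero => exact ⟨0, by norm_num⟩
  | succ t ih =>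
    obtain ⟨i, h1, h2⟩ := ih
    by_cases h : t + 1 < 2 ^ (i + 2) - 2
    · exact ⟨i, by omega, h⟩
    · have := pow_phase (i + 1)
      have h3 : 2 ^ (i + 1 + 2) = 2 * 2 ^ (i + 1 + 1) := by ring
      have h4 : i + 1 + 1 = i + 2 := rfl
      rw [h4] at *
      exact ⟨i + 1, by rw [h4]; omega, by omega⟩

theorem mem_phase_iff {l : List β} {x : β} {i : ℕ} :
    x ∈ phase i l ↔
      ∃ t, 2 ^ (i + 1) - 2 ≤ t ∧ t < 2 ^ (i + 2) - 2 ∧ ∃ h : t < l.length, l[t] = x := by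
  have := pow_phase i
  have h3 : 2 ^ (i + 2) = 2 * 2 ^ (i + 1) := by ring
  unfold phase
  rw [List.mem_iff_getElem]
  constructor
  · rintro ⟨s, hs, rfl⟩
    simp only [List.length_take, List.length_drop] at hs
    exact ⟨2 ^ (i + 1) - 2 + s, by omega, by omega, by omega, by simp⟩
  · rintro ⟨t, h1, h2, ht, rfl⟩
    refine ⟨t - (2 ^ (i + 1) - 2), ?_, ?_⟩
    · simp only [List.length_take, List.length_drop]; omega
    · simp only [List.getElem_take, List.getElem_drop]
      congr 1; omega

theorem phase_nodup {l : List β} (h : l.Nodup) (i : ℕ) : (phase i l).Nodup :=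
  (h.sublist (List.drop_sublist _ _)).sublist (List.take_sublist _ _)

theorem eq_of_mem_phase {l : List β} (hl : l.Nodup) {x : β} {i j : ℕ} (hi : x ∈ phase i l)
    (hj : x ∈ phase j l) : i = j := by
  obtain ⟨s, hs1, hs2, hs, hsx⟩ := mem_phase_iff.1 hi
  obtain ⟨t, ht1, ht2, ht, htx⟩ := mem_phase_iff.1 hj
  have : s = t := (hl.getElem_inj_iff).1 (hsx.trans htx.symm)
  subst this
  exact phase_unique hs1 hs2 ht1 ht2

end Phases

theorem mem_of_mem_out {B : OnlineAlgorithm α} {l : List α} (hl : l.Nodup) {w : Sym2 α → ℚ}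
    {C : Finset α} (hC : C ∈ B.out l w) {a : α} (ha : a ∈ C) : a ∈ l := by
  rw [← List.mem_toFinset, ← (B.isPartition l w hl).support]
  exact Finset.mem_biUnion.2 ⟨C, hC, ha⟩

theorem mem_doublingOut {A : ℕ → OnlineAlgorithm α} {l : List α} {w : Sym2 α → ℚ}
    (hl : l.Nodup) {C : Finset α} :
    C ∈ doublingOut A l w ↔ ∃ i, C ∈ (A (2 ^ (i + 1))).out (phase i l) w := by
  unfold doublingOut
  simp only [Finset.mem_biUnion, Finset.mem_range]
  refine ⟨fun ⟨i, _, h⟩ => ⟨i, h⟩, fun ⟨i, h⟩ => ⟨i, ?_, h⟩⟩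
  have hP := (isPartition_iff _ _).1 ((A (2 ^ (i + 1))).isPartition _ w (phase_nodup hl i))
  have hne : C.Nonempty := Finset.nonempty_iff_ne_empty.2 fun h0 => hP.1 (h0 ▸ h)
  obtain ⟨a, ha⟩ := hne
  obtain ⟨t, h1, -, h2, -⟩ := mem_phase_iff.1 (mem_of_mem_out (phase_nodup hl i) h ha)
  have h4 : i < 2 ^ i := Nat.lt_two_pow_self
  have h5 : 2 ^ (i + 1) = 2 * 2 ^ i := by ring
  omega

theorem doublingOut_isPartition (A : ℕ → OnlineAlgorithm α) (l : List α) (w : Sym2 α → ℚ)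
    (hl : l.Nodup) : IsPartition l.toFinset (doublingOut A l w) := by
  have hP := fun i =>
    (isPartition_iff _ _).1 ((A (2 ^ (i + 1))).isPartition _ w (phase_nodup hl i))
  refine (isPartition_iff _ _).2 ⟨?_, ?_, ?_⟩
  · rw [mem_doublingOut hl]
    rintro ⟨i, hi⟩
    exact (hP i).1 hi
  · intro C hC D hD a haC haD
    obtain ⟨i, hi⟩ := (mem_doublingOut hl).1 hC
    obtain ⟨j, hj⟩ := (mem_doublingOut hl).1 hD
    have hij := eq_of_mem_phase hl (mem_of_mem_out (phase_nodup hl i) hi haC)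
      (mem_of_mem_out (phase_nodup hl j) hj haD)
    subst hij
    exact (hP i).2.1 C hi D hj a haC haD
  · ext a
    simp only [Finset.mem_biUnion, id, List.mem_toFinset]
    constructor
    · rintro ⟨C, hC, ha⟩
      obtain ⟨i, hi⟩ := (mem_doublingOut hl).1 hC
      obtain ⟨t, -, -, h, rfl⟩ := mem_phase_iff.1 (mem_of_mem_out (phase_nodup hl i) hi ha)
      exact List.getElem_mem h
    · intro ha
      obtain ⟨t, ht, rfl⟩ := List.mem_iff_getElem.1 ha
      obtain ⟨i, h1, h2⟩ := exists_phase t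
      have hm : l[t] ∈ phase i l := mem_phase_iff.2 ⟨t, h1, h2, ht, rfl⟩
      rw [← List.mem_toFinset, ← (hP i).2.2] at hm
      obtain ⟨C, hC, haC⟩ := Finset.mem_biUnion.1 hm
      exact ⟨C, (mem_doublingOut hl).2 ⟨i, hC⟩, haC⟩

theorem mem_removeAgent {π : Finset (Finset α)} {x : α} {C : Finset α} :
    C ∈ removeAgent π x ↔ C ≠ ∅ ∧ ∃ D ∈ π, D.erase x = C := by
  simp [removeAgent]

theorem doublingOut_mem_available (A : ℕ → OnlineAlgorithm α) (l : List α) (x : α)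
    (w : Sym2 α → ℚ) (hl : (l ++ [x]).Nodup) :
    doublingOut A (l ++ [x]) w ∈ available (doublingOut A l w) x := by
  have hl' : l.Nodup := hl.sublist (List.sublist_append_left _ _)
  have hx : x ∉ l := fun h => by
    rw [List.nodup_append] at hl
    exact hl.2.2 x h x (by simp) rfl
  have hxp : ∀ i, ∀ C ∈ (A (2 ^ (i + 1))).out (phase i l) w, x ∉ C := by
    intro i C hC hxC
    obtain ⟨t, -, -, h, rfl⟩ := mem_phase_iff.1 (mem_of_mem_out (phase_nodup hl' i) hC hxC)
    exact hx (List.getElem_mem h)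
  have hstep : ∀ i, removeAgent ((A (2 ^ (i + 1))).out (phase i (l ++ [x])) w) x =
      (A (2 ^ (i + 1))).out (phase i l) w := by
    intro i
    by_cases h : 2 ^ (i + 1) - 2 ≤ l.length ∧ l.length < 2 ^ (i + 2) - 2
    · have hn := phase_nodup hl i
      rw [phase_append_of_mem h.1 h.2] at hn ⊢
      exact ((A _).mem_available _ x w hn).2
    · rw [phase_append_of_notMem h]
      refine removeAgent_of_notMem ((A _).isPartition _ w (phase_nodup hl' i)) fun hm => ?_
      obtain ⟨t, -, -, h, rfl⟩ := mem_phase_iff.1 (List.mem_toFinset.1 hm)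
      exact hx (List.getElem_mem h)
  refine ⟨?_, ?_⟩
  · rw [(doublingOut_isPartition A l w hl').support]
    have := doublingOut_isPartition A (l ++ [x]) w hl
    rwa [show (l ++ [x]).toFinset = insert x l.toFinset by ext; simp] at this
  · ext C
    rw [mem_removeAgent, mem_doublingOut hl']
    simp only [mem_doublingOut hl, ← hstep, mem_removeAgent]
    constructor
    · rintro ⟨h0, D, ⟨i, hi⟩, hD⟩
      exact ⟨i, h0, D, hi, hD⟩
    · rintro ⟨i, h0, D, hi, hD⟩
      exact ⟨h0, D, ⟨i, hi⟩, hD⟩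

/-- The iterated doubling variant of an algorithm for a known number of agents. It is an online
algorithm for an unknown number of agents. -/
def iteratedDoubling (A : ℕ → OnlineAlgorithm α) : OnlineAlgorithm α where
  out := doublingOut A
  locality l w w' hl h := by
    unfold doublingOut
    refine Finset.biUnion_congr rfl fun i _ => (A _).locality _ w w' (phase_nodup hl i) fun x hx y hy hxy => ?_
    obtain ⟨s, -, -, hs, rfl⟩ := mem_phase_iff.1 hx
    obtain ⟨t, -, -, ht, rfl⟩ := mem_phase_iff.1 hy
    exact h _ (List.getElem_mem hs) _ (List.getElem_mem ht) hxy
  isPartition := doublingOut_isPartition A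
  mem_available := doublingOut_mem_available A

/-! ### The waiting greedy algorithm exists -/

theorem socialWelfare_congr {S : Finset α} {π : Finset (Finset α)} (h : IsPartition S π)
    {w w' : Sym2 α → ℚ} (hw : ∀ x ∈ S, ∀ y ∈ S, x ≠ y → w s(x, y) = w' s(x, y)) :
    socialWelfare w π = socialWelfare w' π := by
  have hS : ∀ C ∈ π, ∀ a ∈ C, a ∈ S := fun C hC a ha =>
    h.support ▸ Finset.mem_biUnion.2 ⟨C, hC, ha⟩
  refine Finset.sum_congr rfl fun C hC => Finset.sum_congr rfl fun i hi =>
    Finset.sum_congr rfl fun j hj => ?_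
  rw [Finset.mem_erase] at hj
  exact hw i (hS C hC i hi) j (hS C hC j hj.2) (Ne.symm hj.1)

theorem isGreedyStep_congr {S : Finset α} {π : Finset (Finset α)} (h : IsPartition S π) (x : α)
    {w w' : Sym2 α → ℚ}
    (hw : ∀ a ∈ insert x S, ∀ b ∈ insert x S, a ≠ b → w s(a, b) = w' s(a, b)) :
    IsGreedyStep w π x = IsGreedyStep w' π x := by
  have h1 : socialWelfare w π = socialWelfare w' π := socialWelfare_congr h
    fun a ha b hb => hw a (Finset.mem_insert_of_mem ha) b (Finset.mem_insert_of_mem hb)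
  have h2 : ∀ ρ ∈ available π x, socialWelfare w ρ = socialWelfare w' ρ := fun ρ hρ => by
    have := hρ.1
    rw [h.support] at this
    exact socialWelfare_congr this hw
  have h3 : (∃ ρ ∈ available π x, socialWelfare w π < socialWelfare w ρ) ↔
      ∃ ρ ∈ available π x, socialWelfare w' π < socialWelfare w' ρ :=
    exists_congr fun ρ => and_congr_right fun hρ => by rw [h1, h2 ρ hρ]
  funext π'
  unfold IsGreedyStep
  rw [h3]
  refine propext (and_congr (imp_congr_right fun _ => and_congr_right fun h' => ?_) Iff.rfl)
  exact forall_congr' fun ρ => imp_congr_right fun hρ => by rw [h2 ρ hρ, h2 π' h']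

theorem exists_isGreedyStep (w : Sym2 α → ℚ) (π : Finset (Finset α)) (x : α) :
    ∃ π', IsGreedyStep w π x π' := by
  by_cases h : ∃ ρ ∈ available π x, socialWelfare w π < socialWelfare w ρ
  · have hfin : (available π x).Finite := by
      refine (Finset.finite_toSet (insert x (π.biUnion id)).powerset.powerset).subset ?_
      intro ρ hρ
      rw [Finset.mem_coe, Finset.mem_powerset]
      intro C hC
      rw [Finset.mem_powerset, ← hρ.1.support]
      exact Finset.subset_biUnion_of_mem id hC
    obtain ⟨π', h1, h2⟩ := Set.exists_max_image _ (socialWelfare w) hfin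
      ⟨h.choose, h.choose_spec.1⟩
    exact ⟨π', fun _ => ⟨h1, h2⟩, fun h' => absurd h h'⟩
  · exact ⟨_, fun h' => absurd h' h, fun _ => rfl⟩

/-- The waiting greedy algorithm with some tie-breaking, on the reversed list of agents. -/
noncomputable def waitingOut (n : ℕ) (w : Sym2 α → ℚ) : List α → Finset (Finset α)
  | [] => ∅
  | x :: r =>
    if r.length < n / 2 then insert {x} (waitingOut n w r)
    else Classical.epsilon (IsGreedyStep w (waitingOut n w r) x)

theorem waitingOut_mem_available (n : ℕ) (w : Sym2 α → ℚ) (r : List α) (x : α)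
    (hx : x ∉ r) (hP : IsPartition r.toFinset (waitingOut n w r)) :
    waitingOut n w (x :: r) ∈ available (waitingOut n w r) x := by
  have h1 := insert_singleton_mem_available hP (fun h => hx (List.mem_toFinset.1 h))
  rw [waitingOut]
  split_ifs
  · exact h1
  · have hs := Classical.epsilon_spec (exists_isGreedyStep w (waitingOut n w r) x)
    by_cases h : ∃ ρ ∈ available (waitingOut n w r) x,
      socialWelfare w (waitingOut n w r) < socialWelfare w ρ
    · exact (hs.1 h).1
    · rw [hs.2 h]
      exact h1

theorem waitingOut_isPartition (n : ℕ) (w : Sym2 α → ℚ) (r : List α) (hr : r.Nodup) :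
    IsPartition r.toFinset (waitingOut n w r) := by
  induction r with
  | nil => exact ⟨⊥, by simp [waitingOut]⟩
  | cons x r ih =>
    rw [List.nodup_cons] at hr
    have := (waitingOut_mem_available n w r x hr.1 (ih hr.2)).1
    rwa [(ih hr.2).support, ← List.toFinset_cons] at this

theorem waitingOut_congr (n : ℕ) {w w' : Sym2 α → ℚ} (r : List α)
    (h : ∀ x ∈ r, ∀ y ∈ r, x ≠ y → w s(x, y) = w' s(x, y)) (hr : r.Nodup) :
    waitingOut n w r = waitingOut n w' r := by
  induction r with
  | nil => rfl
  | cons x r ih =>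
    rw [List.nodup_cons] at hr
    have ih' := ih (fun a ha b hb => h a (List.mem_cons_of_mem _ ha) b (List.mem_cons_of_mem _ hb))
      hr.2
    have hg := isGreedyStep_congr (waitingOut_isPartition n w' r hr.2) x (w := w) (w' := w')
      (fun a ha b hb => h a (by simpa using ha) b (by simpa using hb))
    rw [waitingOut, waitingOut, ih', hg]

/-- There is an algorithm satisfying the definition of the waiting greedy algorithm. -/
theorem exists_isWaitingGreedy : ∃ W : ℕ → OnlineAlgorithm α, IsWaitingGreedy W := by
  refine ⟨fun n =>
    { out := fun l w => waitingOut n w l.reverse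
      locality := fun l w w' hl h => waitingOut_congr n l.reverse
        (fun x hx y hy => h x (List.mem_reverse.1 hx) y (List.mem_reverse.1 hy))
        (List.nodup_reverse.2 hl)
      isPartition := fun l w hl => ?_
      mem_available := fun l x w hl => ?_ }, ?_⟩
  · have := waitingOut_isPartition n w l.reverse (List.nodup_reverse.2 hl)
    rwa [List.toFinset_reverse] at this
  · have h := List.nodup_reverse.2 hl
    rw [List.reverse_append, List.reverse_singleton, List.singleton_append] at h ⊢
    rw [List.nodup_cons] at h
    exact waitingOut_mem_available n w _ x h.1 (waitingOut_isPartition n w _ h.2)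
  · intro n _ l x w _ _
    simp only [List.reverse_append, List.reverse_singleton, List.singleton_append]
    rw [waitingOut, List.length_reverse]
    refine ⟨fun h => by rw [if_pos h], fun h => ?_⟩
    rw [if_neg (not_lt.2 h)]
    exact Classical.epsilon_spec (exists_isGreedyStep w (waitingOut n w l.reverse) x)

end OnlineCoalition

set_option linter.unusedSectionVars false

namespace OnlineCoalition

universe u

variable {α : Type u} [DecidableEq α]

/-! Lower bound. Every step of the waiting greedy algorithm has nonnegative gain, so every phase has
nonnegative welfare and it suffices to bound one of them: a complete phase of `2 * h` agents with `n
≤ 8 * h` (`exists_large_phase`). Follow the `potential`, the positive weight between the still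
isolated agents of the first half and the agents yet to come. An agent arriving in the second half
may join any isolated agent, so the welfare increment at that step bounds each positive weight
between it and an isolated agent. The potential thus loses at most `h` increments through the
arriving agent. It also loses the remaining positive weight of the at most one isolated agent that
gets a partner, and each such weight is at most the increment in the order where the later agent is
exchanged with the arriving one. Exchanging two arrival times permutes the orders, so on average
each step costs at most `2 * h` increments (`sum_potential_sub_le`). Telescoping bounds the expected
initial potential by `2 * h` times the expected welfare of the phase. By symmetry (`sum_orders_eq`)
this initial potential is `h ^ 2 / (n * (n - 1))` times the sum of the positive weights over all
ordered pairs, which is at least the optimum.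

Upper bound. Take a heavy edge `s(a, b)`, split the other agents into halves `X` and `Y`, let `a` be
attracted by `X` and `b` by `Y` with weight 1, and make every other weight so negative that agents
in a common coalition always attract each other. Suppose `b` arrives after `a` and joins it. Then
`b` lies in the second half of their phase, and no agent of `X` may have been matched with `a`
before. Hence the agents of `X` preceding `b` in this phase, and `a` itself if there are any, lie in
the first half (`IsWaitingGreedy.lt_half_of_together`). So `b` is the first of `insert b X` in the
second half of the phase of `a`. By symmetry among these agents the probability is at most `1 / (|X|
+ 1) ≤ 4 / n`. With the opposite order this gives `8 / n`, and without the heavy edge the welfare is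
at most a `1 / n` fraction of the optimum. -/

/-! ### Single steps of an online algorithm -/

/-- The partition obtained from `π` when `x` joins the coalition `C`; for `C = ∅` the agent `x`
forms a singleton coalition. -/
def joinCoalition (π : Finset (Finset α)) (C : Finset α) (x : α) : Finset (Finset α) :=
  insert (insert x C) (π.erase C)

/-- Half of the increase of the social welfare when `x` joins `C`. -/
def gain (w : Sym2 α → ℚ) (x : α) (C : Finset α) : ℚ :=
  ∑ c ∈ C, w s(c, x)

/-- The agents `p` and `q` are in a common coalition of `π`. -/
def Together (π : Finset (Finset α)) (p q : α) : Prop :=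
  ∃ C ∈ π, p ∈ C ∧ q ∈ C

theorem IsPartition.notMem_of_notMem {S : Finset α} {π : Finset (Finset α)} (h : IsPartition S π)
    {x : α} (hx : x ∉ S) {C : Finset α} (hC : C ∈ π) : x ∉ C := fun hxC =>
  hx (h.support ▸ Finset.mem_biUnion.2 ⟨C, hC, hxC⟩)

theorem IsPartition.exists_mem {S : Finset α} {π : Finset (Finset α)} (h : IsPartition S π)
    {x : α} (hx : x ∈ S) : ∃ C ∈ π, x ∈ C := by
  rw [← h.support] at hx
  simpa using hx

theorem IsPartition.eq_of_mem {S : Finset α} {π : Finset (Finset α)} (h : IsPartition S π)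
    {x : α} {C D : Finset α} (hC : C ∈ π) (hD : D ∈ π) (hxC : x ∈ C) (hxD : x ∈ D) : C = D :=
  ((isPartition_iff S π).1 h).2.1 C hC D hD x hxC hxD

theorem IsPartition.notMem_of_mem_insert_empty {S : Finset α} {π : Finset (Finset α)}
    (h : IsPartition S π) {x : α} (hx : x ∉ S) {C : Finset α} (hC : C ∈ insert ∅ π) : x ∉ C := by
  rcases Finset.mem_insert.1 hC with rfl | hC
  · simp
  · exact h.notMem_of_notMem hx hC

theorem joinCoalition_empty {S : Finset α} {π : Finset (Finset α)} (h : IsPartition S π) (x : α) :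
    joinCoalition π ∅ x = insert {x} π := by
  rw [joinCoalition, Finset.erase_eq_of_notMem ((isPartition_iff S π).1 h).1]
  rfl

theorem joinCoalition_mem_available {S : Finset α} {π : Finset (Finset α)} (h : IsPartition S π)
    {x : α} (hx : x ∉ S) {C : Finset α} (hC : C ∈ insert ∅ π) :
    joinCoalition π C x ∈ available π x := by
  rcases Finset.mem_insert.1 hC with rfl | hC
  · rw [joinCoalition_empty h]
    exact insert_singleton_mem_available h hx
  have hr := removeAgent_of_notMem h hx
  have hxC := h.notMem_of_notMem hx hC
  obtain ⟨h0, h1, h2⟩ := (isPartition_iff S π).1 h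
  refine ⟨(isPartition_iff _ _).2 ⟨?_, ?_, ?_⟩, ?_⟩
  · simp only [joinCoalition, Finset.mem_insert, Finset.mem_erase, not_or]
    exact ⟨(Finset.insert_ne_empty _ _).symm, fun h => h0 h.2⟩
  · intro D hD E hE a haD haE
    simp only [joinCoalition, Finset.mem_insert, Finset.mem_erase] at hD hE
    rcases hD with rfl | ⟨hDC, hD⟩ <;> rcases hE with rfl | ⟨hEC, hE⟩
    · rfl
    · rcases Finset.mem_insert.1 haD with rfl | haC
      · exact absurd haE (h.notMem_of_notMem hx hE)
      · exact absurd (h1 E hE C hC a haE haC) hEC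
    · rcases Finset.mem_insert.1 haE with rfl | haC
      · exact absurd haD (h.notMem_of_notMem hx hD)
      · exact absurd (h1 D hD C hC a haD haC) hDC
    · exact h1 D hD E hE a haD haE
  · ext a
    simp only [joinCoalition, Finset.mem_biUnion, Finset.mem_insert, Finset.mem_erase, id]
    constructor
    · rintro ⟨D, rfl | ⟨-, hD⟩, ha⟩
      · rcases Finset.mem_insert.1 ha with rfl | ha
        · exact Or.inl rfl
        · exact Or.inr ⟨C, hC, ha⟩
      · exact Or.inr ⟨D, hD, ha⟩
    · rintro (rfl | ⟨D, hD, ha⟩)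
      · exact ⟨_, Or.inl rfl, Finset.mem_insert_self _ _⟩
      · by_cases hDC : D = C
        · exact ⟨_, Or.inl rfl, Finset.mem_insert_of_mem (hDC ▸ ha)⟩
        · exact ⟨D, Or.inr ⟨hDC, hD⟩, ha⟩
  · ext D
    rw [mem_removeAgent]
    simp only [joinCoalition, Finset.mem_insert, Finset.mem_erase]
    constructor
    · rintro ⟨hne, E, rfl | ⟨-, hE⟩, rfl⟩
      · rwa [Finset.erase_insert hxC]
      · rwa [Finset.erase_eq_of_notMem (h.notMem_of_notMem hx hE)]
    · intro hD
      refine ⟨fun h => h0 (h ▸ hD), ?_⟩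
      by_cases hDC : D = C
      · exact ⟨_, Or.inl rfl, by rw [hDC, Finset.erase_insert hxC]⟩
      · exact ⟨D, Or.inr ⟨hDC, hD⟩, Finset.erase_eq_of_notMem (h.notMem_of_notMem hx hD)⟩

/-- The coalition to be joined is that of `x` in `π'` with `x` removed, which is empty exactly when
`x` is alone. Together with `joinCoalition_mem_available` this turns maximizing welfare over
available partitions into maximizing `gain` over coalitions. -/
theorem exists_joinCoalition_of_mem_available {π π' : Finset (Finset α)} {x : α}
    (hπ' : π' ∈ available π x) : ∃ C ∈ insert ∅ π, π' = joinCoalition π C x := by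
  obtain ⟨hP, hr⟩ := hπ'
  obtain ⟨E, hE, hxE⟩ := hP.exists_mem (Finset.mem_insert_self x _)
  have hmem : ∀ D, D ∈ π ↔ D ≠ ∅ ∧ ∃ F ∈ π', F.erase x = D := fun D => by
    rw [← mem_removeAgent, hr]
  have hother : ∀ F ∈ π', F ≠ E → x ∉ F := fun F hF hne hxF => hne (hP.eq_of_mem hF hE hxF hxE)
  have hne : ∀ F ∈ π', F ≠ ∅ := fun F hF h0 => ((isPartition_iff _ _).1 hP).1 (h0 ▸ hF)
  refine ⟨E.erase x, ?_, ?_⟩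
  · rw [Finset.mem_insert, or_iff_not_imp_left]
    exact fun h0 => (hmem _).2 ⟨h0, E, hE, rfl⟩
  · ext D
    simp only [joinCoalition, Finset.mem_insert, Finset.mem_erase, Finset.insert_erase hxE]
    constructor
    · intro hD
      by_cases hDE : D = E
      · exact Or.inl hDE
      · have hxD := hother D hD hDE
        refine Or.inr ⟨fun hD' => ?_, (hmem D).2 ⟨hne D hD, D, hD, Finset.erase_eq_of_notMem hxD⟩⟩
        obtain ⟨a, ha⟩ := Finset.nonempty_iff_ne_empty.2 (hne D hD)
        exact hDE (hP.eq_of_mem hD hE ha (Finset.mem_of_mem_erase (hD' ▸ ha)))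
    · rintro (rfl | ⟨hDE, hD⟩)
      · exact hE
      · obtain ⟨-, F, hF, rfl⟩ := (hmem D).1 hD
        have hFE : F ≠ E := fun h => hDE (h ▸ rfl)
        rwa [Finset.erase_eq_of_notMem (hother F hF hFE)]

theorem sum_utility_insert (w : Sym2 α → ℚ) {x : α} {C : Finset α} (hx : x ∉ C) :
    ∑ i ∈ insert x C, utility w i (insert x C) = ∑ i ∈ C, utility w i C + 2 * gain w x C := by
  have h1 : utility w x (insert x C) = gain w x C := by
    rw [utility, Finset.erase_insert hx, gain]
    exact Finset.sum_congr rfl fun c _ => by rw [Sym2.eq_swap]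
  have h2 : ∀ i ∈ C, utility w i (insert x C) = utility w i C + w s(i, x) := fun i hi => by
    have hix : x ≠ i := fun h => hx (h ▸ hi)
    rw [utility, Finset.erase_insert_of_ne hix, Finset.sum_insert (by simp [hx]), add_comm]
    rfl
  rw [Finset.sum_insert hx, h1, Finset.sum_congr rfl h2, Finset.sum_add_distrib]
  simp only [gain]
  ring

theorem socialWelfare_joinCoalition (w : Sym2 α → ℚ) {S : Finset α} {π : Finset (Finset α)}
    (h : IsPartition S π) {x : α} (hx : x ∉ S) {C : Finset α} (hC : C ∈ insert ∅ π) :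
    socialWelfare w (joinCoalition π C x) = socialWelfare w π + 2 * gain w x C := by
  have hxC := h.notMem_of_mem_insert_empty hx hC
  have hn : insert x C ∉ π.erase C := fun hm =>
    h.notMem_of_notMem hx (Finset.mem_of_mem_erase hm) (Finset.mem_insert_self x C)
  rw [socialWelfare, joinCoalition, Finset.sum_insert hn, sum_utility_insert w hxC]
  rcases Finset.mem_insert.1 hC with rfl | hC
  · rw [Finset.erase_eq_of_notMem ((isPartition_iff S π).1 h).1, socialWelfare]
    simp [gain]
  · rw [socialWelfare, ← Finset.add_sum_erase π _ hC]
    ring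

/-- Both branches of the greedy rule take one form: when nothing improves the welfare, `x` joins `∅`
with gain 0, and this is maximal because all other gains are nonpositive. -/
theorem IsGreedyStep.exists_join {w : Sym2 α → ℚ} {S : Finset α} {π π' : Finset (Finset α)}
    {x : α} (hg : IsGreedyStep w π x π') (h : IsPartition S π) (hx : x ∉ S) :
    ∃ C ∈ insert ∅ π, π' = joinCoalition π C x ∧ 0 ≤ gain w x C ∧
      ∀ D ∈ π, gain w x D ≤ gain w x C := by
  have hle : ∀ D ∈ insert ∅ π, socialWelfare w (joinCoalition π D x) =
      socialWelfare w π + 2 * gain w x D := fun D hD => socialWelfare_joinCoalition w h hx hD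
  by_cases he : ∃ ρ ∈ available π x, socialWelfare w π < socialWelfare w ρ
  · obtain ⟨h1, h2⟩ := hg.1 he
    obtain ⟨C, hC, rfl⟩ := exists_joinCoalition_of_mem_available h1
    have h3 : ∀ D ∈ insert ∅ π, gain w x D ≤ gain w x C := fun D hD => by
      have := h2 _ (joinCoalition_mem_available h hx hD)
      rw [hle D hD, hle C hC] at this
      linarith
    exact ⟨C, hC, rfl, by simpa [gain] using h3 ∅ (by simp),
      fun D hD => h3 D (Finset.mem_insert_of_mem hD)⟩
  · refine ⟨∅, by simp, by rw [hg.2 he, joinCoalition_empty h], by simp [gain], fun D hD => ?_⟩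
    push Not at he
    have := he _ (joinCoalition_mem_available h hx (Finset.mem_insert_of_mem hD))
    rw [hle D (Finset.mem_insert_of_mem hD)] at this
    simp only [gain, Finset.sum_empty] at this ⊢
    linarith

section Step

variable {W : ℕ → OnlineAlgorithm α} {m : ℕ} {l : List α} {x : α} {w : Sym2 α → ℚ}

theorem IsWaitingGreedy.exists_join (hW : IsWaitingGreedy W) (hm : Even m)
    (hl : (l ++ [x]).Nodup) (hlen : l.length < m) :
    ∃ C ∈ insert ∅ ((W m).out l w), (W m).out (l ++ [x]) w = joinCoalition ((W m).out l w) C x ∧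
      0 ≤ gain w x C ∧ (l.length < m / 2 → C = ∅) ∧
      (m / 2 ≤ l.length → ∀ D ∈ (W m).out l w, gain w x D ≤ gain w x C) := by
  have hl' : l.Nodup := hl.sublist (List.sublist_append_left _ _)
  have hx : x ∉ l.toFinset := fun h => by
    rw [List.nodup_append] at hl
    exact hl.2.2 x (List.mem_toFinset.1 h) x (by simp) rfl
  have hP := (W m).isPartition l w hl'
  obtain ⟨h1, h2⟩ := hW m hm l x w hl hlen
  by_cases h : l.length < m / 2
  · exact ⟨∅, by simp, by rw [h1 h, joinCoalition_empty hP], by simp [gain], fun _ => rfl,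
      fun h' => absurd h (not_lt.2 h')⟩
  · obtain ⟨C, hC, h3, h4, h5⟩ := (h2 (not_lt.1 h)).exists_join hP hx
    exact ⟨C, hC, h3, h4, fun h' => absurd h' h, fun _ => h5⟩

theorem IsWaitingGreedy.socialWelfare_step (hW : IsWaitingGreedy W) (hm : Even m)
    (hl : (l ++ [x]).Nodup) (hlen : l.length < m) :
    socialWelfare w ((W m).out l w) ≤ socialWelfare w ((W m).out (l ++ [x]) w) := by
  have hl' : l.Nodup := hl.sublist (List.sublist_append_left _ _)
  have hx : x ∉ l.toFinset := fun h => by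
    rw [List.nodup_append] at hl
    exact hl.2.2 x (List.mem_toFinset.1 h) x (by simp) rfl
  obtain ⟨C, hC, h1, h2, -⟩ := hW.exists_join (w := w) hm hl hlen
  rw [h1, socialWelfare_joinCoalition w ((W m).isPartition l w hl') hx hC]
  linarith

theorem IsWaitingGreedy.gain_le (hW : IsWaitingGreedy W) (hm : Even m)
    (hl : (l ++ [x]).Nodup) (hlen : l.length < m) (hlen' : m / 2 ≤ l.length)
    {D : Finset α} (hD : D ∈ (W m).out l w) :
    2 * gain w x D ≤
      socialWelfare w ((W m).out (l ++ [x]) w) - socialWelfare w ((W m).out l w) := by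
  have hl' : l.Nodup := hl.sublist (List.sublist_append_left _ _)
  have hx : x ∉ l.toFinset := fun h => by
    rw [List.nodup_append] at hl
    exact hl.2.2 x (List.mem_toFinset.1 h) x (by simp) rfl
  obtain ⟨C, hC, h1, -, -, h2⟩ := hW.exists_join (w := w) hm hl hlen
  rw [h1, socialWelfare_joinCoalition w ((W m).isPartition l w hl') hx hC]
  linarith [h2 hlen' D hD]

end Step

theorem OnlineAlgorithm.out_nil (A : OnlineAlgorithm α) (w : Sym2 α → ℚ) : A.out [] w = ∅ := by
  have h := (isPartition_iff _ _).1 (A.isPartition [] w List.nodup_nil)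
  refine Finset.eq_empty_of_forall_notMem fun C hC => h.1 ?_
  have : C ⊆ ∅ := by
    have h3 := Finset.subset_biUnion_of_mem id hC
    rwa [h.2.2] at h3
  rwa [← Finset.subset_empty.1 this]

theorem IsWaitingGreedy.socialWelfare_nonneg {W : ℕ → OnlineAlgorithm α} (hW : IsWaitingGreedy W)
    {m : ℕ} (hm : Even m) (w : Sym2 α → ℚ) (l : List α) (hl : l.Nodup) (hlen : l.length ≤ m) :
    0 ≤ socialWelfare w ((W m).out l w) := by
  induction l using List.reverseRecOn with
  | nil => simp [OnlineAlgorithm.out_nil, socialWelfare]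
  | append_singleton l x ih =>
    rw [List.length_append, List.length_singleton] at hlen
    exact (ih (hl.sublist (List.sublist_append_left _ _)) (by omega)).trans
      (hW.socialWelfare_step hm hl (by omega))

theorem IsWaitingGreedy.singleton_mem {W : ℕ → OnlineAlgorithm α} (hW : IsWaitingGreedy W)
    {m : ℕ} (hm : Even m) (w : Sym2 α → ℚ) (l : List α) (hl : l.Nodup) (hlen : l.length ≤ m / 2)
    {z : α} (hz : z ∈ l) : {z} ∈ (W m).out l w := by
  induction l using List.reverseRecOn with
  | nil => simp at hz
  | append_singleton l x ih =>
    rw [List.length_append, List.length_singleton] at hlen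
    rw [(hW m hm l x w hl (by omega)).1 (by omega), Finset.mem_insert]
    rcases List.mem_append.1 hz with h | h
    · exact Or.inr (ih (hl.sublist (List.sublist_append_left _ _)) (by omega) h)
    · rw [List.mem_singleton.1 h]
      exact Or.inl rfl

theorem phase_length_le (i : ℕ) (l : List α) : (phase i l).length ≤ 2 ^ (i + 1) := by
  simp [phase]

theorem even_two_pow_succ (i : ℕ) : Even (2 ^ (i + 1)) := by
  rw [pow_succ]; exact even_two.mul_left _

/-- Coalitions are nonempty and their members arrive in a single phase, so the families formed in
different phases are disjoint. -/
theorem socialWelfare_doublingOut (A : ℕ → OnlineAlgorithm α) {l : List α} (hl : l.Nodup)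
    (w : Sym2 α → ℚ) : socialWelfare w (doublingOut A l w) =
      ∑ i ∈ Finset.range l.length, socialWelfare w ((A (2 ^ (i + 1))).out (phase i l) w) := by
  unfold socialWelfare doublingOut
  refine Finset.sum_biUnion fun i _ j _ hij => Finset.disjoint_left.2 fun C hi hj => hij ?_
  have hP := (isPartition_iff _ _).1 ((A (2 ^ (i + 1))).isPartition _ w (phase_nodup hl i))
  obtain ⟨a, ha⟩ := Finset.nonempty_iff_ne_empty.2 fun h0 : C = ∅ => hP.1 (h0 ▸ hi)
  exact eq_of_mem_phase hl (mem_of_mem_out (phase_nodup hl i) hi ha)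
    (mem_of_mem_out (phase_nodup hl j) hj ha)

theorem IsWaitingGreedy.socialWelfare_phase_le {W : ℕ → OnlineAlgorithm α}
    (hW : IsWaitingGreedy W) {l : List α} (hl : l.Nodup) (w : Sym2 α → ℚ) {i : ℕ}
    (hi : i < l.length) : socialWelfare w ((W (2 ^ (i + 1))).out (phase i l) w) ≤
      socialWelfare w (doublingOut W l w) := by
  rw [socialWelfare_doublingOut W hl]
  exact Finset.single_le_sum
    (f := fun i => socialWelfare w ((W (2 ^ (i + 1))).out (phase i l) w))
    (fun j _ => hW.socialWelfare_nonneg (even_two_pow_succ j) w _ (phase_nodup hl j)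
      (phase_length_le j l)) (Finset.mem_range.2 hi)

theorem IsWaitingGreedy.socialWelfare_doublingOut_nonneg {W : ℕ → OnlineAlgorithm α}
    (hW : IsWaitingGreedy W) {l : List α} (hl : l.Nodup) (w : Sym2 α → ℚ) :
    0 ≤ socialWelfare w (doublingOut W l w) := by
  rw [socialWelfare_doublingOut W hl]
  exact Finset.sum_nonneg fun j _ => hW.socialWelfare_nonneg (even_two_pow_succ j) w _
    (phase_nodup hl j) (phase_length_le j l)

theorem socialWelfare_le_optWelfare (G : Game α) {π : Finset (Finset α)}
    (h : IsPartition G.agents π) : socialWelfare G.weight π ≤ optWelfare G := by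
  obtain ⟨P, rfl⟩ := h
  exact Finset.le_sup' (fun P : Finpartition G.agents => socialWelfare G.weight P.parts)
    (Finset.mem_univ P)

theorem arrivalList_nodup (N : Finset α) (σ : Fin N.card ≃ N) : (arrivalList N σ).Nodup :=
  List.nodup_ofFn.2 (Subtype.val_injective.comp σ.injective)

theorem arrivalList_toFinset (N : Finset α) (σ : Fin N.card ≃ N) :
    (arrivalList N σ).toFinset = N := by
  ext a
  rw [List.mem_toFinset, arrivalList, List.mem_ofFn]
  constructor
  · rintro ⟨i, rfl⟩
    exact (σ i).2
  · intro ha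
    exact ⟨σ.symm ⟨a, ha⟩, by simp⟩

theorem length_arrivalList (N : Finset α) (σ : Fin N.card ≃ N) :
    (arrivalList N σ).length = N.card := List.length_ofFn

theorem getElem_arrivalList (N : Finset α) (σ : Fin N.card ≃ N) (t : ℕ)
    (ht : t < (arrivalList N σ).length) :
    (arrivalList N σ)[t] = σ ⟨t, length_arrivalList N σ ▸ ht⟩ := by
  simp [arrivalList]

/-! ### The lower bound -/

theorem sum_trans_left {β γ : Type*} [Fintype (β ≃ γ)] (e : Equiv.Perm β) (f : (β ≃ γ) → ℚ) :
    ∑ σ, f (e.trans σ) = ∑ σ, f σ :=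
  Fintype.sum_equiv (Equiv.equivCongr e.symm (Equiv.refl γ)) _ _ fun _ => rfl

/-! ### Uniform orders and the exchange of two arrival times. -/

section Orders

variable {N : Finset α} [NeZero N.card]

/-- The agent arriving at time `t` (modulo the number of agents). -/
def agentAt (σ : Fin N.card ≃ N) (t : ℕ) : α :=
  σ (Fin.ofNat N.card t)

/-- The order in which the agents arriving at the times `a` and `b` are exchanged. -/
def swapTimes (σ : Fin N.card ≃ N) (a b : ℕ) : Fin N.card ≃ N :=
  (Equiv.swap (Fin.ofNat N.card a) (Fin.ofNat N.card b)).trans σ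

/-- The list of the `k` agents arriving from time `s` on. -/
def segment (σ : Fin N.card ≃ N) (s k : ℕ) : List α :=
  ((arrivalList N σ).drop s).take k

theorem ofNat_ne {a b : ℕ} (ha : a < N.card) (hb : b < N.card) (h : a ≠ b) :
    Fin.ofNat N.card a ≠ Fin.ofNat N.card b := fun he => h (by
  have := congrArg Fin.val he
  simpa [Fin.ofNat, Nat.mod_eq_of_lt ha, Nat.mod_eq_of_lt hb] using this)

theorem agentAt_inj (σ : Fin N.card ≃ N) {a b : ℕ} (ha : a < N.card) (hb : b < N.card)
    (h : agentAt σ a = agentAt σ b) : a = b := by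
  by_contra hne
  exact ofNat_ne ha hb hne (σ.injective (Subtype.val_injective h))

theorem agentAt_swapTimes_left (σ : Fin N.card ≃ N) (a b : ℕ) :
    agentAt (swapTimes σ a b) a = agentAt σ b := by
  simp [agentAt, swapTimes]

theorem agentAt_swapTimes_of_ne (σ : Fin N.card ≃ N) {a b t : ℕ} (ha : a < N.card)
    (hb : b < N.card) (ht : t < N.card) (hta : t ≠ a) (htb : t ≠ b) :
    agentAt (swapTimes σ a b) t = agentAt σ t := by
  rw [agentAt, swapTimes, Equiv.trans_apply,
    Equiv.swap_apply_of_ne_of_ne (ofNat_ne ht ha hta) (ofNat_ne ht hb htb), agentAt]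

theorem getElem_arrivalList_eq_agentAt (σ : Fin N.card ≃ N) (t : ℕ)
    (ht : t < (arrivalList N σ).length) : (arrivalList N σ)[t] = agentAt σ t := by
  rw [getElem_arrivalList]
  have h : t < N.card := length_arrivalList N σ ▸ ht
  unfold agentAt
  congr 2
  exact Fin.ext (Nat.mod_eq_of_lt h).symm

theorem length_segment (σ : Fin N.card ≃ N) {s k : ℕ} (h : s + k ≤ N.card) :
    (segment σ s k).length = k := by
  simp only [segment, List.length_take, List.length_drop, length_arrivalList]
  omega

theorem segment_nodup (σ : Fin N.card ≃ N) (s k : ℕ) : (segment σ s k).Nodup :=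
  ((arrivalList_nodup N σ).sublist (List.drop_sublist _ _)).sublist (List.take_sublist _ _)

theorem getElem_segment (σ : Fin N.card ≃ N) {s k t : ℕ} (ht : t < (segment σ s k).length) :
    (segment σ s k)[t] = agentAt σ (s + t) := by
  simp only [segment, List.getElem_take, List.getElem_drop, getElem_arrivalList_eq_agentAt]

theorem segment_succ (σ : Fin N.card ≃ N) {s k : ℕ} (h : s + k < N.card) :
    segment σ s (k + 1) = segment σ s k ++ [agentAt σ (s + k)] := by
  have h1 : k < ((arrivalList N σ).drop s).length := by
    simp only [List.length_drop, length_arrivalList]; omega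
  unfold segment
  rw [List.take_add_one, List.getElem?_eq_getElem h1, List.getElem_drop,
    getElem_arrivalList_eq_agentAt]
  rfl

/-- What the algorithm has done before a step depends only on earlier arrivals. Two orders that
differ by exchanging later arrivals therefore meet the same partition at that step. -/
theorem segment_swapTimes (σ : Fin N.card ≃ N) {s k a b : ℕ} (ha : s + k ≤ a) (hb : s + k ≤ b)
    (ha' : a < N.card) (hb' : b < N.card) : segment (swapTimes σ a b) s k = segment σ s k := by
  have hk : s + k ≤ N.card := by omega
  refine List.ext_getElem (by rw [length_segment _ hk, length_segment _ hk]) fun t h1 h2 => ?_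
  rw [length_segment _ hk] at h1
  rw [getElem_segment, getElem_segment, agentAt_swapTimes_of_ne σ ha' hb' (by omega) (by omega)
    (by omega)]

theorem sum_swapTimes (f : (Fin N.card ≃ N) → ℚ) (a b : ℕ) :
    ∑ σ, f (swapTimes σ a b) = ∑ σ, f σ :=
  sum_trans_left _ f

end Orders

/-- The positive part of the weight between `x` and `y`. -/
def posWeight (w : Sym2 α → ℚ) (x y : α) : ℚ :=
  max (w s(x, y)) 0

theorem posWeight_nonneg (w : Sym2 α → ℚ) (x y : α) : 0 ≤ posWeight w x y := le_max_right _ _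

/-- Negative weights are replaced by 0 and pairs in different coalitions are added; the sum runs
over ordered pairs, as the welfare does. -/
theorem optWelfare_le_sum_posWeight (G : Game α) :
    optWelfare G ≤ ∑ x ∈ G.agents, ∑ y ∈ G.agents.erase x, posWeight G.weight x y := by
  refine Finset.sup'_le _ _ fun P _ => ?_
  have h : ∀ C ∈ P.parts, ∑ i ∈ C, utility G.weight i C ≤
      ∑ x ∈ C, ∑ y ∈ G.agents.erase x, posWeight G.weight x y := fun C hC => by
    refine Finset.sum_le_sum fun x _ => ?_
    refine (Finset.sum_le_sum fun y _ => le_max_left (G.weight s(x, y)) 0).trans ?_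
    exact Finset.sum_le_sum_of_subset_of_nonneg (Finset.erase_subset_erase _ (P.le hC))
      fun y _ _ => posWeight_nonneg _ _ _
  refine (Finset.sum_le_sum h).trans (le_of_eq ?_)
  exact (Finset.sum_biUnion (t := id)
    (f := fun x => ∑ y ∈ G.agents.erase x, posWeight G.weight x y) P.disjoint).symm.trans
    (by rw [P.biUnion_parts])

/-! ### The potential argument within one phase. -/

section Potential

variable {N : Finset α} [NeZero N.card] (W : ℕ → OnlineAlgorithm α) (w : Sym2 α → ℚ)
  (s h : ℕ)

/-- The partition formed by the algorithm told `2 * h` after the agents arriving at the times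
`s, ..., s + k - 1`. -/
def partialOut (σ : Fin N.card ≃ N) (k : ℕ) : Finset (Finset α) :=
  (W (2 * h)).out (segment σ s k) w

/-- The increase of the social welfare at the `k`th step. -/
def increment (σ : Fin N.card ≃ N) (k : ℕ) : ℚ :=
  socialWelfare w (partialOut W w s h σ (k + 1)) - socialWelfare w (partialOut W w s h σ k)

/-- The total positive weight between the agents of the first half that still are in singleton
coalitions and the agents that arrive at the step `k` or later. -/
def potential (σ : Fin N.card ≃ N) (k : ℕ) : ℚ :=
  ∑ i ∈ Finset.range h, if {agentAt σ (s + i)} ∈ partialOut W w s h σ k then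
    ∑ j ∈ Finset.Ico k (2 * h), posWeight w (agentAt σ (s + i)) (agentAt σ (s + j)) else 0

variable {W s h}

theorem increment_nonneg (hW : IsWaitingGreedy W) (hs : s + 2 * h ≤ N.card) (σ : Fin N.card ≃ N)
    {k : ℕ} (hk : k < 2 * h) : 0 ≤ increment W w s h σ k := by
  rw [increment, sub_nonneg, partialOut, partialOut]
  have hn := segment_nodup σ s (k + 1)
  rw [segment_succ σ (by omega)] at hn ⊢
  exact hW.socialWelfare_step (even_two_mul h) hn (by rw [length_segment σ (by omega)]; omega)

/-- Joining the singleton `{x}` is one of the options of the arriving agent, and so is staying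
alone, which accounts for the positive part. -/
theorem posWeight_le_increment (hW : IsWaitingGreedy W) (hs : s + 2 * h ≤ N.card)
    (σ : Fin N.card ≃ N) {k : ℕ} (hk : k < 2 * h) (hk' : h ≤ k) {x : α}
    (hx : {x} ∈ partialOut W w s h σ k) :
    posWeight w x (agentAt σ (s + k)) ≤ increment W w s h σ k := by
  have h0 := increment_nonneg w hW hs σ hk
  refine max_le ?_ h0
  have hn := segment_nodup σ s (k + 1)
  rw [segment_succ σ (by omega)] at hn
  have hlen := length_segment σ (s := s) (k := k) (by omega)
  have := hW.gain_le (w := w) (even_two_mul h) hn (by omega) (by omega) hx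
  rw [increment, partialOut, partialOut, segment_succ σ (by omega)] at *
  simp only [gain, Finset.sum_singleton] at this
  linarith

/-- Each isolated agent loses its weight to the arriving agent, at most one increment. Only the
agent whose singleton `C` is joined also loses its weights to future agents. The weight to the one
arriving at step `j` is compared with the increment in the order where that agent arrives at step
`k` instead. -/
theorem potential_sub_le (hW : IsWaitingGreedy W) (hs : s + 2 * h ≤ N.card) (σ : Fin N.card ≃ N)
    {k : ℕ} (hk : k < 2 * h) (hk' : h ≤ k) :
    potential W w s h σ k - potential W w s h σ (k + 1) ≤ h * increment W w s h σ k +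
      ∑ j ∈ Finset.Ico (k + 1) (2 * h), increment W w s h (swapTimes σ (s + k) (s + j)) k := by
  set B := ∑ j ∈ Finset.Ico (k + 1) (2 * h), increment W w s h (swapTimes σ (s + k) (s + j)) k
    with hB
  have hB0 : 0 ≤ B := Finset.sum_nonneg fun j _ => increment_nonneg w hW hs _ hk
  have hn := segment_nodup σ s (k + 1)
  rw [segment_succ σ (by omega)] at hn
  have hlen := length_segment σ (s := s) (k := k) (by omega)
  obtain ⟨C, -, hC, -⟩ := hW.exists_join (w := w) (even_two_mul h) hn (by omega)
  rw [← segment_succ σ (by omega)] at hC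
  have hg := increment_nonneg w hW hs σ hk
  have hterm : ∀ i ∈ Finset.range h,
      ((if {agentAt σ (s + i)} ∈ partialOut W w s h σ k then
        ∑ j ∈ Finset.Ico k (2 * h), posWeight w (agentAt σ (s + i)) (agentAt σ (s + j)) else 0) -
      if {agentAt σ (s + i)} ∈ partialOut W w s h σ (k + 1) then
        ∑ j ∈ Finset.Ico (k + 1) (2 * h), posWeight w (agentAt σ (s + i)) (agentAt σ (s + j))
        else 0) ≤
      increment W w s h σ k + if {agentAt σ (s + i)} = C then B else 0 := by
    intro i _
    have hnn : 0 ≤ ∑ j ∈ Finset.Ico (k + 1) (2 * h),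
        posWeight w (agentAt σ (s + i)) (agentAt σ (s + j)) :=
      Finset.sum_nonneg fun j _ => posWeight_nonneg _ _ _
    by_cases h1 : {agentAt σ (s + i)} ∈ partialOut W w s h σ k
    · rw [if_pos h1, Finset.sum_eq_sum_Ico_succ_bot hk]
      have h2 := posWeight_le_increment w hW hs σ hk hk' h1
      by_cases h3 : {agentAt σ (s + i)} = C
      · rw [if_pos h3]
        have h4 : ∑ j ∈ Finset.Ico (k + 1) (2 * h),
            posWeight w (agentAt σ (s + i)) (agentAt σ (s + j)) ≤ B := by
          refine Finset.sum_le_sum fun j hj => ?_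
          rw [Finset.mem_Ico] at hj
          -- In the exchanged order the same agent is still isolated before step `k`, and the future
          -- agent now arrives.
          have h5 := posWeight_le_increment w hW hs (swapTimes σ (s + k) (s + j)) hk hk'
            (x := agentAt σ (s + i)) (by
              rwa [partialOut, segment_swapTimes σ (by omega) (by omega) (by omega) (by omega)])
          rwa [agentAt_swapTimes_left] at h5
        split_ifs <;> linarith
      · rw [if_neg h3, if_pos]
        · linarith
        · rw [partialOut, hC, joinCoalition]
          exact Finset.mem_insert_of_mem (Finset.mem_erase.2 ⟨h3, h1⟩)
    · rw [if_neg h1]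
      split_ifs <;> linarith
  rw [potential, potential, ← Finset.sum_sub_distrib]
  refine (Finset.sum_le_sum hterm).trans ?_
  rw [Finset.sum_add_distrib, Finset.sum_const, Finset.card_range, nsmul_eq_mul, ← Finset.sum_filter,
    Finset.sum_const, nsmul_eq_mul]
  -- Agents at different times are distinct, so `C` is the singleton of at most one of them and `B`
  -- is paid at most once.
  have hcard : (((Finset.range h).filter fun i => {agentAt σ (s + i)} = C).card : ℚ) ≤ 1 := by
    norm_cast
    refine Finset.card_le_one.2 fun i hi j hj => ?_
    rw [Finset.mem_filter, Finset.mem_range] at hi hj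
    have := agentAt_inj σ (by omega) (by omega)
      (Finset.singleton_injective (hi.2.trans hj.2.symm))
    omega
  nlinarith

/-- Summed over all orders, every exchanged increment equals the original one. The coefficient is `h
+ (2 * h - (k + 1))`, which is at most `2 * h` since `h ≤ k`. -/
theorem sum_potential_sub_le (hW : IsWaitingGreedy W) (hs : s + 2 * h ≤ N.card) {k : ℕ}
    (hk : k < 2 * h) (hk' : h ≤ k) :
    ∑ σ : Fin N.card ≃ N, (potential W w s h σ k - potential W w s h σ (k + 1)) ≤
      2 * h * ∑ σ : Fin N.card ≃ N, increment W w s h σ k := by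
  refine (Finset.sum_le_sum fun σ _ => potential_sub_le w hW hs σ hk hk').trans ?_
  rw [Finset.sum_add_distrib, Finset.sum_comm, ← Finset.mul_sum]
  have : ∀ j ∈ Finset.Ico (k + 1) (2 * h),
      ∑ σ : Fin N.card ≃ N, increment W w s h (swapTimes σ (s + k) (s + j)) k =
        ∑ σ : Fin N.card ≃ N, increment W w s h σ k := fun j _ =>
    sum_swapTimes (fun σ => increment W w s h σ k) _ _
  rw [Finset.sum_congr rfl this, Finset.sum_const, Nat.card_Ico, nsmul_eq_mul, ← add_mul]
  refine mul_le_mul_of_nonneg_right ?_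
    (Finset.sum_nonneg fun σ _ => increment_nonneg w hW hs σ hk)
  norm_cast
  omega

/-- The potential telescopes over the second half and vanishes at the end, while the increments
telescope to at most the final welfare, the welfare after the first half being nonnegative. -/
theorem sum_potential_le (hW : IsWaitingGreedy W) (hs : s + 2 * h ≤ N.card) :
    ∑ σ : Fin N.card ≃ N, potential W w s h σ h ≤
      2 * h * ∑ σ : Fin N.card ≃ N, socialWelfare w (partialOut W w s h σ (2 * h)) := by
  have key : ∑ k ∈ Finset.Ico h (2 * h), ∑ σ : Fin N.card ≃ N,
      (potential W w s h σ k - potential W w s h σ (k + 1)) ≤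
      ∑ k ∈ Finset.Ico h (2 * h), 2 * h * ∑ σ : Fin N.card ≃ N, increment W w s h σ k :=
    Finset.sum_le_sum fun k hk => by
      rw [Finset.mem_Ico] at hk
      exact sum_potential_sub_le w hW hs hk.2 hk.1
  rw [← Finset.mul_sum, Finset.sum_comm, Finset.sum_comm (s := Finset.Ico h (2 * h))] at key
  have h1 : ∀ f : ℕ → ℚ, ∑ k ∈ Finset.Ico h (2 * h), (f (k + 1) - f k) = f (2 * h) - f h :=
    fun f => Finset.sum_Ico_sub f (by omega)
  have h2 : ∀ σ : Fin N.card ≃ N, potential W w s h σ (2 * h) = 0 := fun σ => by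
    simp [potential]
  have h3 : ∀ σ : Fin N.card ≃ N, ∑ k ∈ Finset.Ico h (2 * h),
      (potential W w s h σ k - potential W w s h σ (k + 1)) = potential W w s h σ h := fun σ => by
    have := h1 (fun k => - potential W w s h σ k)
    simp only [h2] at this
    rw [Finset.sum_congr rfl (fun k _ => (neg_sub_neg _ _).symm), this]
    simp
  have h4 : ∀ σ : Fin N.card ≃ N, ∑ k ∈ Finset.Ico h (2 * h), increment W w s h σ k ≤
      socialWelfare w (partialOut W w s h σ (2 * h)) := fun σ => by
    simp only [increment]
    rw [h1 (fun k => socialWelfare w (partialOut W w s h σ k))]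
    have := hW.socialWelfare_nonneg (even_two_mul h) w (segment σ s h) (segment_nodup _ _ _)
      (by rw [length_segment σ (by omega)]; omega)
    exact sub_le_self _ this
  simp only [h3] at key
  refine key.trans (mul_le_mul_of_nonneg_left (Finset.sum_le_sum fun σ _ => h4 σ) (by positivity))

theorem potential_half (hW : IsWaitingGreedy W) (hs : s + 2 * h ≤ N.card) (σ : Fin N.card ≃ N) :
    potential W w s h σ h = ∑ i ∈ Finset.range h, ∑ j ∈ Finset.Ico h (2 * h),
      posWeight w (agentAt σ (s + i)) (agentAt σ (s + j)) := by
  refine Finset.sum_congr rfl fun i hi => if_pos ?_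
  rw [Finset.mem_range] at hi
  have hlen := length_segment σ (s := s) (k := h) (by omega)
  refine hW.singleton_mem (even_two_mul h) w _ (segment_nodup _ _ _) (by omega) ?_
  exact List.mem_iff_getElem.2 ⟨i, by omega, getElem_segment σ _⟩

end Potential

/-- The agents at two fixed different times form a uniformly distributed ordered pair: permuting
times shows that the sum is the same for all pairs of times, and for each order the sum over all
pairs of times runs through all ordered pairs of agents. -/
theorem sum_orders_eq {N : Finset α} (f : α → α → ℚ) {a b : Fin N.card} (hab : a ≠ b) :
    (N.card * (N.card - 1) : ℚ) * ∑ σ : Fin N.card ≃ N, f (σ a) (σ b) =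
      (Fintype.card (Fin N.card ≃ N) : ℚ) * ∑ x ∈ N, ∑ y ∈ N.erase x, f x y := by
  have h1 : ∀ a' b' : Fin N.card, b' ∈ Finset.univ.erase a' →
      ∑ σ : Fin N.card ≃ N, f (σ a') (σ b') = ∑ σ : Fin N.card ≃ N, f (σ a) (σ b) := by
    intro a' b' hb'
    have hab' : b' ≠ a' := Finset.ne_of_mem_erase hb'
    -- The first transposition takes `a` to `a'`; the second takes the image of `b` to `b'` and
    -- leaves `a'` fixed.
    let e : Equiv.Perm (Fin N.card) :=
      (Equiv.swap a a').trans (Equiv.swap (Equiv.swap a a' b) b')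
    have hea : e a = a' := by
      simp only [e, Equiv.trans_apply, Equiv.swap_apply_left]
      refine Equiv.swap_apply_of_ne_of_ne (fun h => ?_) hab'.symm
      have := congrArg (Equiv.swap a a') h
      rw [Equiv.swap_apply_right, Equiv.swap_apply_self] at this
      exact hab this
    have heb : e b = b' := by
      simp only [e, Equiv.trans_apply, Equiv.swap_apply_left]
    rw [← sum_trans_left e (fun σ : Fin N.card ≃ N => f (σ a) (σ b))]
    simp only [Equiv.trans_apply e, hea, heb]
  have h2 : ∀ σ : Fin N.card ≃ N, ∑ a', ∑ b' ∈ Finset.univ.erase a', f (σ a') (σ b') =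
      ∑ x ∈ N, ∑ y ∈ N.erase x, f x y := by
    intro σ
    rw [← Finset.sum_coe_sort N, ← Equiv.sum_comp σ]
    refine Finset.sum_congr rfl fun a' _ => ?_
    refine Finset.sum_bij (fun b' _ => (σ b' : α)) (fun b' hb' => ?_) (fun b' _ c' _ h => ?_)
      (fun y hy => ?_) fun _ _ => rfl
    · refine Finset.mem_erase.2 ⟨fun h => ?_, (σ b').2⟩
      exact Finset.ne_of_mem_erase hb' (σ.injective (Subtype.val_injective h))
    · exact σ.injective (Subtype.val_injective h)
    · rw [Finset.mem_erase] at hy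
      refine ⟨σ.symm ⟨y, hy.2⟩, ?_, by simp⟩
      simp only [Finset.mem_erase, Finset.mem_univ, and_true]
      intro h
      exact hy.1 (by rw [← h]; simp)
  have h3 : ∑ σ : Fin N.card ≃ N, ∑ a', ∑ b' ∈ Finset.univ.erase a', f (σ a') (σ b') =
      (N.card * (N.card - 1) : ℚ) * ∑ σ : Fin N.card ≃ N, f (σ a) (σ b) := by
    rw [Finset.sum_comm]
    have : ∀ a' ∈ (Finset.univ : Finset (Fin N.card)),
        ∑ σ : Fin N.card ≃ N, ∑ b' ∈ Finset.univ.erase a', f (σ a') (σ b') =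
        (N.card - 1 : ℚ) * ∑ σ : Fin N.card ≃ N, f (σ a) (σ b) := fun a' _ => by
      rw [Finset.sum_comm, Finset.sum_congr rfl (h1 a'), Finset.sum_const,
        Finset.card_erase_of_mem (Finset.mem_univ _), Finset.card_univ, Fintype.card_fin,
        nsmul_eq_mul, Nat.cast_sub (by have := a.2; omega)]
      simp
    rw [Finset.sum_congr rfl this, Finset.sum_const, Finset.card_univ, Fintype.card_fin,
      nsmul_eq_mul]
    ring
  rw [← h3, Finset.sum_congr rfl fun σ _ => h2 σ, Finset.sum_const, Finset.card_univ, nsmul_eq_mul]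

/-- The initial potential consists of `h * h` pairs of times, each contributing the same average;
one factor `h` cancels against the bound of `sum_potential_le`. -/
theorem IsWaitingGreedy.sum_posWeight_le {W : ℕ → OnlineAlgorithm α} (hW : IsWaitingGreedy W)
    (G : Game α) {s h : ℕ} (hs : s + 2 * h ≤ G.agents.card) (hh : 1 ≤ h)
    [NeZero G.agents.card] :
    (h : ℚ) * ((Fintype.card (Fin G.agents.card ≃ G.agents) : ℚ) *
      ∑ x ∈ G.agents, ∑ y ∈ G.agents.erase x, posWeight G.weight x y) ≤
    2 * (G.agents.card * (G.agents.card - 1)) * ∑ σ : Fin G.agents.card ≃ G.agents,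
      socialWelfare G.weight (partialOut W G.weight s h σ (2 * h)) := by
  have h1 := sum_potential_le (N := G.agents) G.weight hW hs
  simp only [potential_half G.weight hW hs] at h1
  rw [Finset.sum_comm, Finset.sum_congr rfl fun i _ => Finset.sum_comm] at h1
  have hn : (1 : ℚ) ≤ G.agents.card := by exact_mod_cast (by omega : 1 ≤ G.agents.card)
  set n := (G.agents.card : ℚ)
  set T := (Fintype.card (Fin G.agents.card ≃ G.agents) : ℚ) *
      ∑ x ∈ G.agents, ∑ y ∈ G.agents.erase x, posWeight G.weight x y
  have h2 := mul_le_mul_of_nonneg_left h1 (show 0 ≤ n * (n - 1) by nlinarith)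
  rw [Finset.mul_sum] at h2
  have h3 : ∀ i ∈ Finset.range h, n * (n - 1) * ∑ j ∈ Finset.Ico h (2 * h),
      ∑ σ : Fin G.agents.card ≃ G.agents,
        posWeight G.weight (agentAt σ (s + i)) (agentAt σ (s + j)) = h * T := by
    intro i hi
    rw [Finset.mem_range] at hi
    rw [Finset.mul_sum, Finset.sum_congr rfl fun j hj => ?_, Finset.sum_const, Nat.card_Ico,
      nsmul_eq_mul, show 2 * h - h = h by omega]
    rw [Finset.mem_Ico] at hj
    exact sum_orders_eq (posWeight G.weight)
      (ofNat_ne (N := G.agents) (a := s + i) (b := s + j) (by omega) (by omega) (by omega))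
  rw [Finset.sum_congr rfl h3, Finset.sum_const, Finset.card_range, nsmul_eq_mul] at h2
  have hh' : (0 : ℚ) < h := by exact_mod_cast hh
  refine le_of_mul_le_mul_left (h2.trans (le_of_eq ?_)) hh'
  ring

/-- The phase just before the one containing time `n` is complete, and the phase lengths double. -/
theorem exists_large_phase {n : ℕ} (hn : 2 ≤ n) :
    ∃ i, 2 ^ (i + 1) - 2 + 2 * 2 ^ i ≤ n ∧ n ≤ 8 * 2 ^ i ∧ i < n := by
  obtain ⟨i, h1, h2⟩ := exists_phase n
  obtain _ | i := i
  · norm_num at h2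
    omega
  · have e1 : 2 ^ (i + 1 + 1) = 4 * 2 ^ i := by ring
    have e2 : 2 ^ (i + 1 + 2) = 8 * 2 ^ i := by ring
    have e3 : 2 ^ (i + 1) = 2 * 2 ^ i := by ring
    have := Nat.one_le_two_pow (n := i)
    have h4 : i < 2 ^ i := Nat.lt_two_pow_self
    rw [e1] at h1
    rw [e2] at h2
    exact ⟨i, by rw [e3]; omega, by omega, by omega⟩

theorem IsWaitingGreedy.expectedWelfare_nonneg {W : ℕ → OnlineAlgorithm α}
    (hW : IsWaitingGreedy W) (G : Game α) : 0 ≤ expectedWelfare (iteratedDoubling W) G :=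
  div_nonneg (Finset.sum_nonneg fun σ _ => hW.socialWelfare_doublingOut_nonneg
    (arrivalList_nodup _ σ) _) (Nat.cast_nonneg _)

theorem expectedWelfare_le_optWelfare (A : OnlineAlgorithm α) (G : Game α) :
    expectedWelfare A G ≤ optWelfare G := by
  have hpos : (0 : ℚ) < Fintype.card (Fin G.agents.card ≃ G.agents) := by
    have : Nonempty (Fin G.agents.card ≃ G.agents) := ⟨G.agents.equivFin.symm⟩
    exact_mod_cast Fintype.card_pos
  rw [expectedWelfare, div_le_iff₀ hpos]
  refine (Finset.sum_le_sum fun σ _ => socialWelfare_le_optWelfare G ?_).trans (le_of_eq ?_)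
  · have := A.isPartition (arrivalList G.agents σ) G.weight (arrivalList_nodup _ σ)
    rwa [arrivalList_toFinset] at this
  · rw [Finset.sum_const, Finset.card_univ, nsmul_eq_mul, mul_comm]

theorem IsWaitingGreedy.optWelfare_le {W : ℕ → OnlineAlgorithm α} (hW : IsWaitingGreedy W)
    (G : Game α) (hn : 2 ≤ G.agents.card) :
    optWelfare G ≤ 16 * G.agents.card * expectedWelfare (iteratedDoubling W) G := by
  have : NeZero G.agents.card := ⟨by omega⟩
  obtain ⟨i, h1, h2, h3⟩ := exists_large_phase hn
  have h4 := hW.sum_posWeight_le G h1 Nat.one_le_two_pow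
  have h5 : ∀ σ : Fin G.agents.card ≃ G.agents,
      socialWelfare G.weight
        (partialOut W G.weight (2 ^ (i + 1) - 2) (2 ^ i) σ (2 * 2 ^ i)) ≤
      socialWelfare G.weight ((iteratedDoubling W).out (arrivalList G.agents σ) G.weight) :=
    fun σ => by
      have := hW.socialWelfare_phase_le (arrivalList_nodup _ σ) G.weight (i := i)
        (by rwa [length_arrivalList])
      unfold phase at this
      rwa [show 2 * 2 ^ i = 2 ^ (i + 1) by ring, partialOut, segment,
        show 2 * 2 ^ i = 2 ^ (i + 1) by ring]
  have h6 := Finset.sum_le_sum fun σ (_ : σ ∈ Finset.univ) => h5 σ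
  have hpos : (0 : ℚ) < Fintype.card (Fin G.agents.card ≃ G.agents) := by
    have : Nonempty (Fin G.agents.card ≃ G.agents) := ⟨G.agents.equivFin.symm⟩
    exact_mod_cast Fintype.card_pos
  have h7 := optWelfare_le_sum_posWeight G
  rw [expectedWelfare, mul_div_assoc', le_div_iff₀ hpos]
  refine (mul_le_mul_of_nonneg_right h7 hpos.le).trans ?_
  rw [mul_comm]
  set T := (Fintype.card (Fin G.agents.card ≃ G.agents) : ℚ) *
      ∑ x ∈ G.agents, ∑ y ∈ G.agents.erase x, posWeight G.weight x y
  set S' := ∑ σ : Fin G.agents.card ≃ G.agents, socialWelfare G.weight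
        (partialOut W G.weight (2 ^ (i + 1) - 2) (2 ^ i) σ (2 * 2 ^ i))
  set S := ∑ σ : Fin G.agents.card ≃ G.agents,
    socialWelfare G.weight ((iteratedDoubling W).out (arrivalList G.agents σ) G.weight)
  have hS : 0 ≤ S := Finset.sum_nonneg fun σ _ => hW.socialWelfare_doublingOut_nonneg
    (arrivalList_nodup _ σ) _
  have hn2 : (2 : ℚ) ≤ G.agents.card := by exact_mod_cast hn
  have h8 : (G.agents.card : ℚ) ≤ 8 * 2 ^ i := by exact_mod_cast h2
  push_cast at h4
  set n := (G.agents.card : ℚ)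
  set p : ℚ := 2 ^ i
  have hp : 0 < p := by positivity
  refine le_of_mul_le_mul_left (h4.trans ?_) hp
  -- The other phases contribute nonnegative welfare; then `n - 1 ≤ 8 * p` gives the constant `16 =
  -- 2 * 8`.
  calc 2 * (n * (n - 1)) * S' ≤ 2 * (n * (n - 1)) * S :=
        mul_le_mul_of_nonneg_left h6 (by nlinarith)
    _ ≤ 2 * (n * (8 * p)) * S := by
        refine mul_le_mul_of_nonneg_right ?_ hS
        refine mul_le_mul_of_nonneg_left ?_ (by norm_num)
        exact mul_le_mul_of_nonneg_left (by linarith) (by linarith)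
    _ = p * (16 * n * S) := by ring

theorem IsWaitingGreedy.le_welfareRatio {W : ℕ → OnlineAlgorithm α} (hW : IsWaitingGreedy W)
    (G : Game α) (hn : 1 ≤ G.agents.card) :
    1 / (16 * G.agents.card : ℚ) ≤
      welfareRatio (expectedWelfare (iteratedDoubling W) G) (optWelfare G) := by
  have h0 := hW.expectedWelfare_nonneg G
  have h1 := expectedWelfare_le_optWelfare (iteratedDoubling W) G
  have hn' : (1 : ℚ) ≤ G.agents.card := by exact_mod_cast hn
  unfold welfareRatio
  split_ifs with hq hp
  · rw [div_le_one (by linarith)]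
    linarith
  -- If the optimum is 0, the expected welfare lies between 0 and 0, so only the convention for `0 /
  -- 0` applies.
  · exact absurd (le_antisymm (hq ▸ h1) h0) hp
  · have hpos : 0 < optWelfare G := lt_of_le_of_ne (h0.trans h1) (Ne.symm hq)
    rw [div_le_div_iff₀ (by linarith) hpos, one_mul, mul_comm]
    refine hW.optWelfare_le G ?_
    -- A game with a single agent has no positive optimum.
    by_contra hlt
    have hone : G.agents.card = 1 := by omega
    have h2 := optWelfare_le_sum_posWeight G
    obtain ⟨a, ha⟩ := Finset.card_eq_one.1 hone
    rw [ha] at h2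
    simp at h2
    linarith

/-! ### The upper bound: coalitions formed in a phase -/

theorem Together.symm {π : Finset (Finset α)} {p q : α} (h : Together π p q) : Together π q p :=
  let ⟨C, hC, hp, hq⟩ := h
  ⟨C, hC, hq, hp⟩

theorem Together.trans {S : Finset α} {π : Finset (Finset α)} (hP : IsPartition S π) {p q r : α}
    (h : Together π p q) (h' : Together π q r) : Together π p r := by
  obtain ⟨C, hC, hp, hq⟩ := h
  obtain ⟨D, hD, hq', hr⟩ := h'
  exact ⟨C, hC, hp, hP.eq_of_mem hD hC hq' hq ▸ hr⟩

theorem notMem_of_nodup_append {l : List α} {z : α} (hl : (l ++ [z]).Nodup) : z ∉ l := fun h => by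
  rw [List.nodup_append] at hl
  exact hl.2.2 z h z (by simp) rfl

theorem OnlineAlgorithm.together_append_singleton (A : OnlineAlgorithm α) (w : Sym2 α → ℚ)
    {l : List α} {z p q : α} (hl : (l ++ [z]).Nodup) (hp : p ∈ l) (hq : q ∈ l) :
    Together (A.out (l ++ [z]) w) p q ↔ Together (A.out l w) p q := by
  have hz := notMem_of_nodup_append hl
  have hpz : p ≠ z := fun h => hz (h ▸ hp)
  have hqz : q ≠ z := fun h => hz (h ▸ hq)
  obtain ⟨C, hC, h⟩ := exists_joinCoalition_of_mem_available (A.mem_available l z w hl)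
  rw [h]
  constructor
  · rintro ⟨D, hD, hpD, hqD⟩
    rcases Finset.mem_insert.1 hD with rfl | hD
    · have hpC := Finset.mem_of_mem_insert_of_ne hpD hpz
      refine ⟨C, ?_, hpC, Finset.mem_of_mem_insert_of_ne hqD hqz⟩
      refine Finset.mem_of_mem_insert_of_ne hC ?_
      rintro rfl
      simp at hpC
    · exact ⟨D, Finset.mem_of_mem_erase hD, hpD, hqD⟩
  · rintro ⟨D, hD, hpD, hqD⟩
    by_cases hDC : D = C
    · exact ⟨_, Finset.mem_insert_self _ _, Finset.mem_insert_of_mem (hDC ▸ hpD),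
        Finset.mem_insert_of_mem (hDC ▸ hqD)⟩
    · exact ⟨D, Finset.mem_insert_of_mem (Finset.mem_erase.2 ⟨hDC, hD⟩), hpD, hqD⟩

/-- Decisions are irrevocable: later arrivals neither merge nor split the coalitions of present
agents. -/
theorem OnlineAlgorithm.together_append (A : OnlineAlgorithm α) (w : Sym2 α → ℚ)
    {l l' : List α} {p q : α} (hl : (l ++ l').Nodup) (hp : p ∈ l) (hq : q ∈ l) :
    Together (A.out (l ++ l') w) p q ↔ Together (A.out l w) p q := by
  induction l' using List.reverseRecOn with
  | nil => simp
  | append_singleton l' z ih =>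
    rw [← List.append_assoc] at hl ⊢
    rw [A.together_append_singleton w hl (List.mem_append_left _ hp) (List.mem_append_left _ hq)]
    exact ih (hl.sublist (List.sublist_append_left _ _))

theorem OnlineAlgorithm.together_take (A : OnlineAlgorithm α) (w : Sym2 α → ℚ)
    {l : List α} (k : ℕ) {p q : α} (hl : l.Nodup) (hp : p ∈ l.take k) (hq : q ∈ l.take k) :
    Together (A.out l w) p q ↔ Together (A.out (l.take k) w) p q := by
  have h := List.take_append_drop k l
  conv_lhs => rw [← h]
  exact A.together_append w (h.symm ▸ hl) hp hq

/-- A single nonpositive weight in a coalition outweighs all positive ones. -/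
def NegativeDominates (w : Sym2 α → ℚ) (N : Finset α) : Prop :=
  ∀ C ⊆ N, ∀ p ∈ C, ∀ q ∈ N, q ∉ C → 0 ≤ gain w q C → 0 < w s(p, q)

/-- An agent never joins with negative gain, and under `NegativeDominates` a nonnegative gain forces
it to have positive weight to every member. Coalitions are thus cliques of positive edges. -/
theorem IsWaitingGreedy.weight_pos_of_together {W : ℕ → OnlineAlgorithm α}
    (hW : IsWaitingGreedy W) {m : ℕ} (hm : Even m) {w : Sym2 α → ℚ} {N : Finset α}
    (hN : NegativeDominates w N) (l : List α) (hl : l.Nodup) (hlen : l.length ≤ m)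
    (hlN : ∀ a ∈ l, a ∈ N) {p q : α} (hpq : p ≠ q) (h : Together ((W m).out l w) p q) :
    0 < w s(p, q) := by
  induction l using List.reverseRecOn generalizing p q with
  | nil =>
    obtain ⟨C, hC, -⟩ := h
    simp [OnlineAlgorithm.out_nil] at hC
  | append_singleton l z ih =>
    rw [List.length_append, List.length_singleton] at hlen
    have hl' : l.Nodup := hl.sublist (List.sublist_append_left _ _)
    have hz := notMem_of_nodup_append hl
    have ih' := fun {p q : α} => @ih hl' (by omega)
      (fun a ha => hlN a (List.mem_append_left _ ha)) p q
    obtain ⟨C, hC, hj, hg, -⟩ := hW.exists_join (w := w) hm hl (by omega)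
    have hCl : ∀ a ∈ C, a ∈ l := fun a ha => by
      rcases Finset.mem_insert.1 hC with rfl | hC
      · simp at ha
      · exact mem_of_mem_out hl' hC ha
    have hnew : ∀ a ∈ C, 0 < w s(a, z) := fun a ha =>
      hN C (fun b hb => hlN b (List.mem_append_left _ (hCl b hb))) a ha z (hlN z (by simp))
        (fun h => hz (hCl z h)) hg
    rw [hj] at h
    obtain ⟨D, hD, hpD, hqD⟩ := h
    rcases Finset.mem_insert.1 hD with rfl | hD
    · rcases Finset.mem_insert.1 hpD with rfl | hpC <;> rcases Finset.mem_insert.1 hqD with rfl | hqC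
      · exact absurd rfl hpq
      · rw [Sym2.eq_swap]
        exact hnew q hqC
      · exact hnew p hpC
      · rcases Finset.mem_insert.1 hC with rfl | hC
        · simp at hpC
        · exact ih' hpq ⟨C, hC, hpC, hqC⟩
    · exact ih' hpq ⟨D, Finset.mem_of_mem_erase hD, hpD, hqD⟩

/-- The agents of `X` are attracted only by `x`, and `x` is attracted only by them and by `y`. -/
structure IsTrap (w : Sym2 α → ℚ) (x y : α) (X : Finset α) : Prop where
  ne : x ≠ y
  left_notMem : x ∉ X
  right_notMem : y ∉ X
  pos : ∀ c ∈ X, 0 < w s(x, c)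
  eq_of_pos : ∀ c ∈ X, ∀ d, 0 < w s(c, d) → d = x
  of_pos : ∀ d, 0 < w s(x, d) → d = y ∨ d ∈ X

section Trap

variable {W : ℕ → OnlineAlgorithm α} {m : ℕ} {w : Sym2 α → ℚ} {N X : Finset α} {x y : α}

/-- An agent arriving in the first half is put alone, so the later of two partners must have arrived
in the second half. -/
theorem IsWaitingGreedy.half_le_of_together (hW : IsWaitingGreedy W) (hm : Even m)
    {l : List α} (hl : l.Nodup) (hlen : l.length ≤ m) {p q : ℕ} (hp : p < l.length)
    (hq : q < l.length) (hpq : p < q) (h : Together ((W m).out l w) l[p] l[q]) : m / 2 ≤ q := by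
  by_contra hlt
  have htake : l.take (q + 1) = l.take q ++ [l[q]] := by
    rw [List.take_add_one, List.getElem?_eq_getElem hq]; rfl
  have hp' : l[p] ∈ l.take q :=
    List.mem_take_iff_getElem.2 ⟨p, by omega, rfl⟩
  have hn : (l.take q ++ [l[q]]).Nodup := htake ▸ hl.sublist (List.take_sublist _ _)
  have hz := notMem_of_nodup_append hn
  rw [(W m).together_take w (q + 1) hl (by rw [htake]; exact List.mem_append_left _ hp')
    (by rw [htake]; exact List.mem_append_right _ (List.mem_singleton_self _)), htake,
    (hW m hm (l.take q) l[q] w hn (by rw [List.length_take]; omega)).1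
      (by rw [List.length_take]; omega)] at h
  obtain ⟨D, hD, hpD, hqD⟩ := h
  rcases Finset.mem_insert.1 hD with rfl | hD
  · rw [Finset.mem_singleton] at hpD
    exact hz (hpD ▸ hp')
  · exact hz (mem_of_mem_out (hl.sublist (List.take_sublist _ _)) hD hqD)

theorem exists_pos_of_gain_pos {w : Sym2 α → ℚ} {z : α} {C : Finset α} (h : 0 < gain w z C) :
    ∃ d ∈ C, 0 < w s(d, z) := by
  by_contra hne
  push Not at hne
  exact absurd (Finset.sum_nonpos hne) (not_le.2 h)

/-- The trap closes as soon as the later of `x` and some `c ∈ X` arrives in the second half, before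
`y`. It finds the other one isolated, or `x` already with an agent of `X`. In the first case its
gain is positive, so it joins someone it likes: for `x` this is an agent of `X`, since `y` is
absent, and for `c` it can only be `x`. -/
theorem IsWaitingGreedy.together_trap (hW : IsWaitingGreedy W) (hm : Even m)
    (hN : NegativeDominates w N) (hT : IsTrap w x y X) {l : List α} (hl : l.Nodup)
    (hlen : l.length < m) (hlN : ∀ a ∈ l, a ∈ N) (hy : y ∉ l) (hhalf : m / 2 ≤ l.length)
    {z c : α} (hz : (l ++ [z]).Nodup) (hc : c ∈ X)
    (hzc : (z = x ∧ c ∈ l) ∨ (z = c ∧ x ∈ l)) :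
    ∃ d ∈ X, d ∈ l ++ [z] ∧ Together ((W m).out (l ++ [z]) w) x d := by
  have hzl := notMem_of_nodup_append hz
  have hP := (W m).isPartition l w hl
  obtain ⟨C, hC, hj, -, -, hg⟩ := hW.exists_join (w := w) hm hz hlen
  have hCl : ∀ a ∈ C, a ∈ l := fun a ha => by
    rcases Finset.mem_insert.1 hC with rfl | hC
    · simp at ha
    · exact mem_of_mem_out hl hC ha
  have hgood := fun {p q : α} => @IsWaitingGreedy.weight_pos_of_together _ _ W hW m hm w N hN l hl
    hlen.le hlN p q
  rcases hzc with ⟨rfl, hcl⟩ | ⟨rfl, hxl⟩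
  · obtain ⟨D, hD, hcD⟩ := hP.exists_mem (List.mem_toFinset.2 hcl)
    -- Only `x` could share a coalition with `c`, and `x` is just arriving.
    have hDc : D = {c} := by
      refine Finset.eq_singleton_iff_unique_mem.2 ⟨hcD, fun d hd => ?_⟩
      by_contra hdc
      have := hT.eq_of_pos c hc d (hgood (Ne.symm hdc) ⟨D, hD, hcD, hd⟩)
      exact hzl (this ▸ mem_of_mem_out hl hD hd)
    have h1 : 0 < gain w z C := by
      refine lt_of_lt_of_le ?_ (hg hhalf D hD)
      rw [hDc, gain, Finset.sum_singleton, Sym2.eq_swap]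
      exact hT.pos c hc
    obtain ⟨d, hd, hdp⟩ := exists_pos_of_gain_pos h1
    rw [Sym2.eq_swap] at hdp
    refine ⟨d, (hT.of_pos d hdp).resolve_left fun h => hy (h ▸ hCl d hd),
      List.mem_append_left _ (hCl d hd), ?_⟩
    rw [hj]
    exact ⟨_, Finset.mem_insert_self _ _, Finset.mem_insert_self _ _, Finset.mem_insert_of_mem hd⟩
  · obtain ⟨D, hD, hxD⟩ := hP.exists_mem (List.mem_toFinset.2 hxl)
    by_cases hDX : ∃ d ∈ D, d ∈ X
    · obtain ⟨d, hd, hdX⟩ := hDX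
      have hdl := mem_of_mem_out hl hD hd
      exact ⟨d, hdX, List.mem_append_left _ hdl,
        ((W m).together_append_singleton w hz hxl hdl).2 ⟨D, hD, hxD, hd⟩⟩
    -- Besides the agents of `X`, only the absent `y` could share a coalition with `x`.
    · have hDx : D = {x} := by
        refine Finset.eq_singleton_iff_unique_mem.2 ⟨hxD, fun d hd => ?_⟩
        by_contra hdx
        rcases hT.of_pos d (hgood (Ne.symm hdx) ⟨D, hD, hxD, hd⟩) with h | h
        · exact hy (h ▸ mem_of_mem_out hl hD hd)
        · exact hDX ⟨d, hd, h⟩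
      have h1 : 0 < gain w z C := by
        refine lt_of_lt_of_le ?_ (hg hhalf D hD)
        rw [hDx, gain, Finset.sum_singleton]
        exact hT.pos z hc
      obtain ⟨d, hd, hdp⟩ := exists_pos_of_gain_pos h1
      rw [Sym2.eq_swap] at hdp
      have := hT.eq_of_pos z hc d hdp
      subst this
      refine ⟨z, hc, by simp, ?_⟩
      rw [hj]
      exact ⟨_, Finset.mem_insert_self _ _, Finset.mem_insert_of_mem hd, Finset.mem_insert_self _ _⟩

/-- Otherwise the later of `x` and `l[r]` arrives in the second half before `y`, and `x` is trapped
with some agent of `X`. That agent would end up together with `y`, although its only positive edge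
leads to `x`. -/
theorem IsWaitingGreedy.lt_half_of_together (hW : IsWaitingGreedy W) (hm : Even m)
    (hN : NegativeDominates w N) (hT : IsTrap w x y X) {l : List α} (hl : l.Nodup)
    (hlen : l.length ≤ m) (hlN : ∀ a ∈ l, a ∈ N) {p q r : ℕ} (hp : p < l.length)
    (hq : q < l.length) (hpq : p < q) (hrq : r < q) (hpx : l[p] = x) (hqy : l[q] = y)
    (hr : l[r] ∈ X) (h : Together ((W m).out l w) x y) : r < m / 2 ∧ p < m / 2 := by
  by_contra hcon
  have hpr : p ≠ r := by
    rintro rfl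
    exact hT.left_notMem (hpx ▸ hr)
  have hidx : ∀ {s t : ℕ} (hs : s < l.length) (ht : t < l.length), l[s] = l[t] → s = t :=
    fun hs ht he => (hl.getElem_inj_iff).1 he
  suffices hs : ∃ t < q, ∃ d ∈ X, d ∈ l.take (t + 1) ∧ x ∈ l.take (t + 1) ∧
      Together ((W m).out (l.take (t + 1)) w) x d by
    obtain ⟨t, -, d, hd, hdl, hxl, hxd⟩ := hs
    rw [← (W m).together_take w (t + 1) hl hxl hdl] at hxd
    have hdy := hxd.symm.trans ((W m).isPartition l w hl) h
    have hne : d ≠ y := fun h => hT.right_notMem (h ▸ hd)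
    exact hT.ne (hT.eq_of_pos d hd y
      (hW.weight_pos_of_together hm hN l hl hlen hlN hne hdy)).symm
  -- Here `t` stands for the larger of `p` and `r`, the moment at which the trap closes.
  have step : ∀ t, (ht : t < q) → m / 2 ≤ t →
      ((l[t] = x ∧ l[r] ∈ l.take t) ∨ (l[t] = l[r] ∧ x ∈ l.take t)) →
      ∃ t < q, ∃ d ∈ X, d ∈ l.take (t + 1) ∧ x ∈ l.take (t + 1) ∧
      Together ((W m).out (l.take (t + 1)) w) x d := by
    intro t ht hmt hcase
    have htake : l.take (t + 1) = l.take t ++ [l[t]] := by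
      rw [List.take_add_one, List.getElem?_eq_getElem (by omega)]; rfl
    have hn : (l.take t ++ [l[t]]).Nodup := htake ▸ hl.sublist (List.take_sublist _ _)
    have hylt : y ∉ l.take t := fun hy => by
      obtain ⟨s, hs, hsy⟩ := List.mem_take_iff_getElem.1 hy
      have := hidx (by omega) hq (hsy.trans hqy.symm)
      omega
    obtain ⟨d, hd, hdl, hxd⟩ := hW.together_trap hm hN hT (hl.sublist (List.take_sublist _ _))
      (by rw [List.length_take]; omega) (fun a ha => hlN a (List.mem_of_mem_take ha)) hylt
      (by rw [List.length_take]; omega) hn hr hcase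
    refine ⟨t, ht, d, hd, htake ▸ hdl, ?_, htake ▸ hxd⟩
    rw [htake]
    rcases hcase with ⟨hx, -⟩ | ⟨-, hx⟩
    · simp [hx]
    · exact List.mem_append_left _ hx
  rcases lt_or_gt_of_ne hpr with hlt | hlt
  · exact step r hrq (by omega)
      (Or.inr ⟨rfl, List.mem_take_iff_getElem.2 ⟨p, by omega, hpx⟩⟩)
  · exact step p hpq (by omega)
      (Or.inl ⟨hpx, List.mem_take_iff_getElem.2 ⟨r, by omega, rfl⟩⟩)

end Trap

/-! ### The upper bound: counting orders -/

/-- The agent `z` arrives in the second half of the phase of `x`, and each agent of `Z` arriving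
before `z` in this phase arrives, like `x`, in its first half. -/
def FirstInSecondHalf {β : Type*} {n : ℕ} (x : β) (Z : Finset β) (σ : Fin n ≃ β) (z : β) : Prop :=
  ∃ i, 2 ^ (i + 1) - 2 ≤ (σ.symm x : ℕ) ∧ (σ.symm x : ℕ) < 2 ^ (i + 2) - 2 ∧
    2 ^ (i + 1) - 2 + 2 ^ i ≤ (σ.symm z : ℕ) ∧ (σ.symm z : ℕ) < 2 ^ (i + 2) - 2 ∧
    ∀ c ∈ Z, 2 ^ (i + 1) - 2 ≤ (σ.symm c : ℕ) → σ.symm c < σ.symm z →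
      (σ.symm c : ℕ) < 2 ^ (i + 1) - 2 + 2 ^ i ∧ (σ.symm x : ℕ) < 2 ^ (i + 1) - 2 + 2 ^ i

/-- The phase is determined by `x`, hence common to `z` and `z'`; an earlier `z` would have to lie
in its first half. -/
theorem FirstInSecondHalf.not_symm_lt {β : Type*} {n : ℕ} {x : β} {Z : Finset β} {σ : Fin n ≃ β}
    {z z' : β} (h : FirstInSecondHalf x Z σ z) (h' : FirstInSecondHalf x Z σ z') (hz : z ∈ Z) :
    ¬ σ.symm z < σ.symm z' := by
  intro hlt
  obtain ⟨i, h1, h2, h3, h4, -⟩ := h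
  obtain ⟨j, h1', h2', h3', h4', h5'⟩ := h'
  obtain rfl := phase_unique h1 h2 h1' h2'
  have := (h5' z hz (by omega) hlt).1
  omega

theorem FirstInSecondHalf.eq {β : Type*} {n : ℕ} {x : β} {Z : Finset β} {σ : Fin n ≃ β}
    {z z' : β} (h : FirstInSecondHalf x Z σ z) (h' : FirstInSecondHalf x Z σ z') (hz : z ∈ Z)
    (hz' : z' ∈ Z) : z = z' :=
  σ.symm.injective (le_antisymm (not_lt.1 (h'.not_symm_lt h hz')) (not_lt.1 (h.not_symm_lt h' hz)))

theorem FirstInSecondHalf.swap {β : Type*} [DecidableEq β] {n : ℕ} {x : β} {Z : Finset β}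
    {σ : Fin n ≃ β} {z z' : β} (h : FirstInSecondHalf x Z σ z) (hx : x ∉ Z) (hz : z ∈ Z)
    (hz' : z' ∈ Z) : FirstInSecondHalf x Z (σ.trans (Equiv.swap z z')) z' := by
  have hxz : x ≠ z := fun h => hx (h ▸ hz)
  have hxz' : x ≠ z' := fun h => hx (h ▸ hz')
  have hZ : ∀ c ∈ Z, Equiv.swap z z' c ∈ Z := fun c hc => by
    rw [Equiv.swap_apply_def]
    split_ifs <;> assumption
  obtain ⟨i, h1, h2, h3, h4, h5⟩ := h
  simp only [FirstInSecondHalf, Equiv.symm_trans_apply, Equiv.symm_swap, Equiv.swap_apply_right,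
    Equiv.swap_apply_of_ne_of_ne hxz hxz']
  exact ⟨i, h1, h2, h3, h4, fun c hc => h5 _ (hZ c hc)⟩

/-- Exchanging `z` with another agent of `Z` maps the event for one injectively into the event for
the other, and the events for different agents of `Z` are disjoint. Each thus has probability at
most `1 / Z.card`. -/
theorem card_mul_card_firstInSecondHalf_le {β : Type*} [Fintype β] [DecidableEq β] {n : ℕ} {x : β}
    {Z : Finset β} (hx : x ∉ Z) {z : β} (hz : z ∈ Z)
    [∀ z, DecidablePred fun σ : Fin n ≃ β => FirstInSecondHalf x Z σ z] :
    Z.card * (Finset.univ.filter fun σ : Fin n ≃ β => FirstInSecondHalf x Z σ z).card ≤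
      Fintype.card (Fin n ≃ β) := by
  have h1 : ∀ z' ∈ Z, (Finset.univ.filter fun σ : Fin n ≃ β => FirstInSecondHalf x Z σ z).card ≤
      (Finset.univ.filter fun σ : Fin n ≃ β => FirstInSecondHalf x Z σ z').card := by
    intro z' hz'
    refine Finset.card_le_card_of_injOn (fun σ => σ.trans (Equiv.swap z z')) (fun σ hσ => ?_)
      (fun σ _ τ _ h => ?_)
    · simp only [Finset.coe_filter, Finset.mem_univ, true_and, Set.mem_ofPred_eq] at hσ ⊢
      exact hσ.swap hx hz hz'
    · ext t
      have := DFunLike.congr_fun h t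
      simpa using this
  calc Z.card * (Finset.univ.filter fun σ : Fin n ≃ β => FirstInSecondHalf x Z σ z).card
      = ∑ _z' ∈ Z, (Finset.univ.filter fun σ : Fin n ≃ β => FirstInSecondHalf x Z σ z).card := by
        rw [Finset.sum_const, smul_eq_mul]
    _ ≤ ∑ z' ∈ Z, (Finset.univ.filter fun σ : Fin n ≃ β => FirstInSecondHalf x Z σ z').card :=
        Finset.sum_le_sum h1
    _ = (Z.biUnion fun z' =>
          Finset.univ.filter fun σ : Fin n ≃ β => FirstInSecondHalf x Z σ z').card := by
        refine (Finset.card_biUnion fun z₁ h₁ z₂ h₂ hne => ?_).symm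
        refine Finset.disjoint_left.2 fun σ hσ hσ' => hne ?_
        rw [Finset.mem_filter] at hσ hσ'
        exact hσ.2.eq hσ'.2 h₁ h₂
    _ ≤ Fintype.card (Fin n ≃ β) := Finset.card_le_univ _

theorem getElem_phase {β : Type*} {l : List β} {i r : ℕ} (hr : r < (phase i l).length) :
    (phase i l)[r] = l[2 ^ (i + 1) - 2 + r]'(by
      simp only [phase, List.length_take, List.length_drop] at hr; omega) := by
  simp [phase]

theorem symm_getElem_phase {N : Finset α} (σ : Fin N.card ≃ N) {i r : ℕ} {u : N}
    (hr : r < (phase i (arrivalList N σ)).length)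
    (hu : (phase i (arrivalList N σ))[r] = u) : (σ.symm u : ℕ) = 2 ^ (i + 1) - 2 + r := by
  rw [getElem_phase, getElem_arrivalList] at hu
  rw [← Subtype.ext hu, Equiv.symm_apply_apply]

theorem getElem_phase_symm {N : Finset α} (σ : Fin N.card ≃ N) {i : ℕ} (u : N)
    (h1 : 2 ^ (i + 1) - 2 ≤ (σ.symm u : ℕ)) (h2 : (σ.symm u : ℕ) < 2 ^ (i + 2) - 2) :
    ∃ hr : (σ.symm u : ℕ) - (2 ^ (i + 1) - 2) < (phase i (arrivalList N σ)).length,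
      (phase i (arrivalList N σ))[(σ.symm u : ℕ) - (2 ^ (i + 1) - 2)] = u := by
  have := (σ.symm u).2
  have h3 : 2 ^ (i + 2) = 2 * 2 ^ (i + 1) := by ring
  have h4 := pow_phase i
  refine ⟨?_, ?_⟩
  · simp only [phase, List.length_take, List.length_drop, length_arrivalList]
    omega
  · rw [getElem_phase, getElem_arrivalList]
    congr 1
    have : ∀ t, (h : t < N.card) → t = (σ.symm u : ℕ) → σ ⟨t, h⟩ = u := fun t h ht => by
      subst ht
      simp
    exact this _ _ (by omega)

/-- Translates the statements about positions within a phase into arrival times. The set includes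
`y` itself, so that `y` can be exchanged with the agents of `X`. -/
theorem IsWaitingGreedy.firstInSecondHalf {W : ℕ → OnlineAlgorithm α} (hW : IsWaitingGreedy W)
    {w : Sym2 α → ℚ} {N X : Finset α} (hN : NegativeDominates w N) {x y : N}
    (hT : IsTrap w (x : α) y X) {σ : Fin N.card ≃ N}
    (h : Together (doublingOut W (arrivalList N σ) w) (x : α) y) (hxy : σ.symm x < σ.symm y) :
    FirstInSecondHalf x ((insert (y : α) X).subtype (· ∈ N)) σ y := by
  have hL := arrivalList_nodup N σ
  obtain ⟨C, hC, hxC, hyC⟩ := h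
  obtain ⟨i, hC⟩ := (mem_doublingOut hL).1 hC
  have hP := phase_nodup hL i
  have hlen := phase_length_le i (arrivalList N σ)
  obtain ⟨p, hp, hpx⟩ := List.mem_iff_getElem.1 (mem_of_mem_out hP hC hxC)
  obtain ⟨q, hq, hqy⟩ := List.mem_iff_getElem.1 (mem_of_mem_out hP hC hyC)
  have hp' := symm_getElem_phase σ hp hpx
  have hq' := symm_getElem_phase σ hq hqy
  have hpq : p < q := by
    have : (σ.symm x : ℕ) < σ.symm y := hxy
    omega
  have h2 : 2 ^ (i + 2) = 2 * 2 ^ (i + 1) := by ring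
  have h3 : 2 ^ (i + 1) / 2 = 2 ^ i := by rw [pow_succ]; omega
  have h4 := pow_phase i
  have hlN : ∀ a ∈ phase i (arrivalList N σ), a ∈ N := fun a ha => by
    rw [← arrivalList_toFinset N σ, List.mem_toFinset]
    exact List.mem_of_mem_drop (List.mem_of_mem_take ha)
  have htog : Together ((W (2 ^ (i + 1))).out (phase i (arrivalList N σ)) w) (x : α) y :=
    ⟨C, hC, hxC, hyC⟩
  have hhalf := hW.half_le_of_together (w := w) (even_two_pow_succ i) hP hlen hp hq hpq
    (by rw [hpx, hqy]; exact htog)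
  refine ⟨i, by omega, by omega, by omega, by omega, fun c hc hc1 hc2 => ?_⟩
  have hc2' : (σ.symm c : ℕ) < σ.symm y := hc2
  obtain ⟨hr, hrc⟩ := getElem_phase_symm σ (i := i) c hc1 (by omega)
  have hcX : (c : α) ∈ X := by
    refine Finset.mem_of_mem_insert_of_ne (Finset.mem_subtype.1 hc) fun h => ?_
    rw [Subtype.ext h] at hc2
    exact lt_irrefl _ hc2
  have := hW.lt_half_of_together (even_two_pow_succ i) hN hT hP hlen hlN hp hq hpq (by omega)
    hpx hqy (r := (σ.symm c : ℕ) - (2 ^ (i + 1) - 2)) (hrc.symm ▸ hcX) htog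
  omega

/-! ### The upper bound: the game -/

/-- The weights with one heavy edge `s(a, b)`, where `a` attracts the agents of `X` and `b`
attracts those of `Y`. -/
def trapWeight (a b : α) (X Y : Finset α) (B M : ℚ) (e : Sym2 α) : ℚ :=
  if e = s(a, b) then B
  else if (∃ c ∈ X, e = s(a, c)) ∨ ∃ c ∈ Y, e = s(b, c) then 1 else -M

/-- The symmetry yields the trap of `b` from that of `a`. -/
theorem trapWeight_comm (a b : α) (X Y : Finset α) (B M : ℚ) :
    trapWeight a b X Y B M = trapWeight b a Y X B M := by
  funext e
  simp only [trapWeight, Sym2.eq_swap (a := a) (b := b), or_comm]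

section TrapWeight

variable {a b : α} {X Y N : Finset α} {B M : ℚ}

theorem trapWeight_self (a b : α) (X Y : Finset α) (B M : ℚ) :
    trapWeight a b X Y B M s(a, b) = B := if_pos rfl

theorem trapWeight_le (hB : 1 ≤ B) (hM : 0 ≤ M) (e : Sym2 α) : trapWeight a b X Y B M e ≤ B := by
  unfold trapWeight
  split_ifs <;> linarith

theorem trapWeight_le_one (hM : 0 ≤ M) {e : Sym2 α} (he : e ≠ s(a, b)) :
    trapWeight a b X Y B M e ≤ 1 := by
  rw [trapWeight, if_neg he]
  split_ifs <;> linarith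

theorem trapWeight_of_not_pos (hB : 0 < B) {e : Sym2 α}
    (he : ¬ 0 < trapWeight a b X Y B M e) : trapWeight a b X Y B M e = -M := by
  unfold trapWeight at he ⊢
  split_ifs at he ⊢ with h1 h2
  · exact absurd hB he
  · exact absurd one_pos he
  · rfl

theorem trapWeight_pos (hM : 0 ≤ M) {e : Sym2 α} (he : 0 < trapWeight a b X Y B M e) :
    e = s(a, b) ∨ (∃ c ∈ X, e = s(a, c)) ∨ ∃ c ∈ Y, e = s(b, c) := by
  unfold trapWeight at he
  split_ifs at he with h1 h2
  · exact Or.inl h1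
  · exact Or.inr h2
  · linarith

theorem isTrap_trapWeight (hab : a ≠ b) (haX : a ∉ X) (hbX : b ∉ X) (haY : a ∉ Y)
    (hXY : Disjoint X Y) (hM : 0 ≤ M) : IsTrap (trapWeight a b X Y B M) a b X where
  ne := hab
  left_notMem := haX
  right_notMem := hbX
  pos c hc := by
    have hcb : c ≠ b := fun h => hbX (h ▸ hc)
    rw [trapWeight, if_neg (by simp [hcb, hab]), if_pos (Or.inl ⟨c, hc, rfl⟩)]
    exact one_pos
  eq_of_pos c hc d hd := by
    have hca : c ≠ a := fun h => haX (h ▸ hc)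
    have hcb : c ≠ b := fun h => hbX (h ▸ hc)
    rcases trapWeight_pos hM hd with h | ⟨e, he, h⟩ | ⟨e, he, h⟩
    · simp [hca, hcb] at h
    · rcases Sym2.eq_iff.1 h with ⟨h, -⟩ | ⟨-, h⟩
      · exact absurd h hca
      · exact h
    · rcases Sym2.eq_iff.1 h with ⟨h, -⟩ | ⟨h, -⟩
      · exact absurd h hcb
      · exact absurd (h ▸ he) (Finset.disjoint_left.1 hXY hc)
  of_pos d hd := by
    rcases trapWeight_pos hM hd with h | ⟨e, he, h⟩ | ⟨e, he, h⟩
    · rcases Sym2.eq_iff.1 h with ⟨-, h⟩ | ⟨h, -⟩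
      · exact Or.inl h
      · exact absurd h hab
    · rcases Sym2.eq_iff.1 h with ⟨-, h⟩ | ⟨h, -⟩
      · exact Or.inr (h ▸ he)
      · exact absurd (h ▸ he) haX
    · rcases Sym2.eq_iff.1 h with ⟨h, -⟩ | ⟨h, -⟩
      · exact absurd h hab
      · exact absurd (h ▸ he) haY

/-- One edge of weight `-M` outweighs all others, whose weights sum to at most `N.card * B`. -/
theorem negativeDominates_trapWeight (hB : 1 ≤ B) (hM : N.card * B < M) :
    NegativeDominates (trapWeight a b X Y B M) N := by
  intro C hC p hp q _ _ hg
  have hM0 : 0 ≤ M := le_trans (by positivity) hM.le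
  by_contra hneg
  refine absurd hg (not_le.2 ?_)
  rw [gain, ← Finset.add_sum_erase C _ hp, trapWeight_of_not_pos (by linarith) hneg]
  have h1 : ∑ c ∈ C.erase p, trapWeight a b X Y B M s(c, q) ≤ N.card * B := by
    refine (Finset.sum_le_card_nsmul _ _ B fun c _ => trapWeight_le hB hM0 _).trans ?_
    rw [nsmul_eq_mul]
    refine mul_le_mul_of_nonneg_right ?_ (by linarith)
    exact_mod_cast Finset.card_le_card ((Finset.erase_subset _ _).trans hC)
  linarith

theorem socialWelfare_le_of_not_together {w : Sym2 α → ℚ} {π : Finset (Finset α)}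
    (hP : IsPartition N π) (h : ∀ p q, Together π p q → w s(p, q) ≤ 1) :
    socialWelfare w π ≤ (N.card : ℚ) ^ 2 := by
  obtain ⟨P, rfl⟩ := hP
  have h1 : ∀ C ∈ P.parts, ∑ i ∈ C, utility w i C ≤ C.card * N.card := fun C hC => by
    rw [← nsmul_eq_mul]
    refine Finset.sum_le_card_nsmul _ _ _ fun i hi => ?_
    refine (Finset.sum_le_card_nsmul _ _ 1 fun j hj =>
      h i j ⟨C, hC, hi, Finset.mem_of_mem_erase hj⟩).trans ?_
    rw [nsmul_eq_mul, mul_one]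
    exact_mod_cast Finset.card_le_card ((Finset.erase_subset _ _).trans (P.le hC))
  refine (Finset.sum_le_sum h1).trans (le_of_eq ?_)
  rw [← Finset.sum_mul, sq]
  congr 1
  exact_mod_cast P.sum_card_parts

/-- The witness is the partition with `{a, b}` as its only nontrivial coalition, obtained by letting
`b` join `{a}` in the discrete partition. -/
theorem two_mul_weight_le_optWelfare (G : Game α) (ha : a ∈ G.agents) (hb : b ∈ G.agents)
    (hab : a ≠ b) : 2 * G.weight s(a, b) ≤ optWelfare G := by
  have hP : IsPartition (G.agents.erase b) (⊥ : Finpartition (G.agents.erase b)).parts := ⟨_, rfl⟩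
  have hmem : {a} ∈ insert ∅ (⊥ : Finpartition (G.agents.erase b)).parts :=
    Finset.mem_insert_of_mem (Finpartition.mem_bot_iff.2 ⟨a, Finset.mem_erase.2 ⟨hab, ha⟩, rfl⟩)
  have hbN := Finset.notMem_erase b G.agents
  have h1 := socialWelfare_joinCoalition G.weight hP hbN hmem
  have h2 := (joinCoalition_mem_available hP hbN hmem).1
  rw [hP.support, Finset.insert_erase hb] at h2
  have h3 : socialWelfare G.weight (⊥ : Finpartition (G.agents.erase b)).parts = 0 := by
    refine Finset.sum_eq_zero fun C hC => ?_
    obtain ⟨i, -, rfl⟩ := Finpartition.mem_bot_iff.1 hC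
    simp [utility]
  rw [h3, gain, Finset.sum_singleton, zero_add] at h1
  exact h1 ▸ socialWelfare_le_optWelfare G h2

end TrapWeight

-- A union bound over which of `a` and `b` arrives first. Each case has probability at most `1 /
-- (X.card + 1)` or `1 / (Y.card + 1)`, hence at most `4 / N.card`.
open Classical in
theorem IsWaitingGreedy.card_together_le {W : ℕ → OnlineAlgorithm α} (hW : IsWaitingGreedy W)
    {w : Sym2 α → ℚ} {N X Y : Finset α} (hN : NegativeDominates w N) {a b : N}
    (hX : IsTrap w (a : α) b X) (hY : IsTrap w (b : α) a Y) (hXN : X ⊆ N) (hYN : Y ⊆ N)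
    (hcX : N.card ≤ 4 * (X.card + 1)) (hcY : N.card ≤ 4 * (Y.card + 1)) :
    N.card * (Finset.univ.filter fun σ : Fin N.card ≃ N =>
      Together (doublingOut W (arrivalList N σ) w) (a : α) b).card ≤
      8 * Fintype.card (Fin N.card ≃ N) := by
  have hab : a ≠ b := fun h => hX.ne (congrArg _ h)
  have hZ : ∀ {x y : N} {X : Finset α}, IsTrap w (x : α) y X → X ⊆ N →
      N.card ≤ 4 * (X.card + 1) → N.card * (Finset.univ.filter fun σ : Fin N.card ≃ N =>
        FirstInSecondHalf x ((insert (y : α) X).subtype (· ∈ N)) σ y).card ≤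
        4 * Fintype.card (Fin N.card ≃ N) := by
    intro x y X hT hXN hc
    have h1 := card_mul_card_firstInSecondHalf_le (n := N.card) (x := x)
      (Z := (insert (y : α) X).subtype (· ∈ N)) (z := y)
      (by
        rw [Finset.mem_subtype, Finset.mem_insert, not_or]
        exact ⟨hT.ne, hT.left_notMem⟩)
      (Finset.mem_subtype.2 (Finset.mem_insert_self _ _))
    have h2 : ((insert (y : α) X).subtype (· ∈ N)).card = X.card + 1 := by
      rw [Finset.card_subtype, Finset.filter_true_of_mem, Finset.card_insert_of_notMem
        hT.right_notMem]
      intro c hc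
      rcases Finset.mem_insert.1 hc with rfl | hc
      · exact y.2
      · exact hXN hc
    rw [h2] at h1
    refine (Nat.mul_le_mul_right _ hc).trans ?_
    rw [mul_assoc]
    exact Nat.mul_le_mul_left 4 h1
  have hsub : (Finset.univ.filter fun σ : Fin N.card ≃ N =>
      Together (doublingOut W (arrivalList N σ) w) (a : α) b) ⊆
      (Finset.univ.filter fun σ : Fin N.card ≃ N =>
        FirstInSecondHalf a ((insert (b : α) X).subtype (· ∈ N)) σ b) ∪
      Finset.univ.filter fun σ : Fin N.card ≃ N =>
        FirstInSecondHalf b ((insert (a : α) Y).subtype (· ∈ N)) σ a := by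
    intro σ hσ
    simp only [Finset.mem_union, Finset.mem_filter, Finset.mem_univ, true_and] at hσ ⊢
    rcases lt_or_gt_of_ne (σ.symm.injective.ne hab) with hlt | hlt
    · exact Or.inl (hW.firstInSecondHalf hN hX hσ hlt)
    · exact Or.inr (hW.firstInSecondHalf hN hY hσ.symm hlt)
  have h1 := (Finset.card_le_card hsub).trans (Finset.card_union_le _ _)
  have h2 := Nat.mul_le_mul_left N.card h1
  rw [mul_add] at h2
  have h3 := hZ hX hXN hcX
  have h4 := hZ hY hYN hcY
  omega

open Classical in
theorem IsWaitingGreedy.exists_welfareRatio_le_of_two_le [Infinite α] {W : ℕ → OnlineAlgorithm α}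
    (hW : IsWaitingGreedy W) {n : ℕ} (hn : 2 ≤ n) : ∃ G : Game α, G.agents.card = n ∧
      welfareRatio (expectedWelfare (iteratedDoubling W) G) (optWelfare G) ≤ 9 / n := by
  obtain ⟨N, rfl⟩ := Infinite.exists_subset_card_eq α n
  obtain ⟨a, ha, b, hb, hab⟩ := Finset.one_lt_card.1 (show 1 < N.card by omega)
  have hcard : ((N.erase a).erase b).card = N.card - 2 := by
    rw [Finset.card_erase_of_mem (Finset.mem_erase.2 ⟨hab.symm, hb⟩), Finset.card_erase_of_mem ha]
    omega
  obtain ⟨X, hX, hXc⟩ := Finset.exists_subset_card_eq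
    (show (N.card - 2) / 2 ≤ ((N.erase a).erase b).card by rw [hcard]; omega)
  set Y := ((N.erase a).erase b) \ X with hY
  have hYc : Y.card = N.card - 2 - (N.card - 2) / 2 := by
    rw [hY, Finset.card_sdiff_of_subset hX, hcard, hXc]
  have hYs : Y ⊆ (N.erase a).erase b := Finset.sdiff_subset
  have hsub : (N.erase a).erase b ⊆ N := (Finset.erase_subset _ _).trans (Finset.erase_subset _ _)
  have haE : a ∉ (N.erase a).erase b := by simp
  have hbE : b ∉ (N.erase a).erase b := by simp
  have hXY : Disjoint X Y := Finset.disjoint_sdiff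
  have hn2 : (2 : ℚ) ≤ N.card := by exact_mod_cast hn
  -- Without the heavy edge the welfare is at most `N.card ^ 2 = B / N.card`, a negligible part of
  -- the optimum, which is at least `2 * B`.
  set B : ℚ := (N.card : ℚ) ^ 3 with hB
  have hB1 : 1 ≤ B := one_le_pow₀ (by linarith)
  set M : ℚ := N.card * B + 1 with hM
  have hM0 : 0 ≤ M := by positivity
  set w := trapWeight a b X Y B M with hw
  have hdom : NegativeDominates w N := negativeDominates_trapWeight hB1 (by linarith)
  have hcnt := hW.card_together_le hdom (a := ⟨a, ha⟩) (b := ⟨b, hb⟩)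
    (isTrap_trapWeight hab (fun h => haE (hX h)) (fun h => hbE (hX h)) (fun h => haE (hYs h))
      hXY hM0)
    (by
      rw [hw, trapWeight_comm]
      exact isTrap_trapWeight hab.symm (fun h => hbE (hYs h)) (fun h => haE (hYs h))
        (fun h => hbE (hX h)) hXY.symm hM0)
    (hX.trans hsub) (hYs.trans hsub) (by omega) (by omega)
  refine ⟨⟨N, w⟩, rfl, ?_⟩
  have hopt := two_mul_weight_le_optWelfare (⟨N, w⟩ : Game α) ha hb hab
  simp only [hw, trapWeight_self] at hopt
  rw [← hw] at hopt
  have hpos : 0 < optWelfare (⟨N, w⟩ : Game α) := by linarith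
  have hF : (0 : ℚ) < Fintype.card (Fin N.card ≃ N) := by
    have : Nonempty (Fin N.card ≃ N) := ⟨N.equivFin.symm⟩
    exact_mod_cast Fintype.card_pos
  -- Orders that realize the heavy edge are credited with the full optimum; averaging then gives `9
  -- = 1 + 8`.
  have hterm : ∀ σ : Fin N.card ≃ N, socialWelfare w (doublingOut W (arrivalList N σ) w) ≤
      (N.card : ℚ) ^ 2 + if Together (doublingOut W (arrivalList N σ) w) a b then
        optWelfare (⟨N, w⟩ : Game α) else 0 := by
    intro σ
    have hP := doublingOut_isPartition W (arrivalList N σ) w (arrivalList_nodup N σ)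
    rw [arrivalList_toFinset] at hP
    split_ifs with ht
    · have := socialWelfare_le_optWelfare (⟨N, w⟩ : Game α) hP
      have h2 : (0 : ℚ) ≤ (N.card : ℚ) ^ 2 := by positivity
      exact this.trans (by linarith)
    · rw [add_zero]
      refine socialWelfare_le_of_not_together hP fun p q hpq => trapWeight_le_one hM0 fun h => ht ?_
      rcases Sym2.eq_iff.1 h with ⟨rfl, rfl⟩ | ⟨rfl, rfl⟩
      · exact hpq
      · exact hpq.symm
  have hsum := Finset.sum_le_sum fun σ (_ : σ ∈ Finset.univ) => hterm σ
  rw [Finset.sum_add_distrib, Finset.sum_const, Finset.card_univ, nsmul_eq_mul,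
    ← Finset.sum_filter, Finset.sum_const, nsmul_eq_mul] at hsum
  rw [welfareRatio, if_neg hpos.ne', div_le_div_iff₀ hpos (by linarith), expectedWelfare,
    div_mul_eq_mul_div, div_le_iff₀ hF]
  have hcnt' : (N.card : ℚ) * ((Finset.univ.filter fun σ : Fin N.card ≃ N =>
      Together (doublingOut W (arrivalList N σ) w) a b).card : ℚ) ≤
      8 * (Fintype.card (Fin N.card ≃ N) : ℚ) := by
    exact_mod_cast hcnt
  set F : ℚ := (Fintype.card (Fin N.card ≃ N) : ℚ)
  set O := optWelfare (⟨N, w⟩ : Game α)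
  set T : ℚ := ((Finset.univ.filter fun σ : Fin N.card ≃ N =>
      Together (doublingOut W (arrivalList N σ) w) a b).card : ℚ)
  refine (mul_le_mul_of_nonneg_right hsum (by linarith)).trans ?_
  have h1 : (N.card : ℚ) * T * O ≤ 8 * F * O := mul_le_mul_of_nonneg_right hcnt' hpos.le
  have h2 : F * B ≤ F * O := mul_le_mul_of_nonneg_left (by linarith) hF.le
  calc (F * (N.card : ℚ) ^ 2 + T * O) * (N.card : ℚ) = F * B + (N.card : ℚ) * T * O := by
        rw [hB]; ring
    _ ≤ F * O + 8 * F * O := add_le_add h2 h1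
    _ = 9 * O * F := by ring

/-- The game with all weights 0 settles the case of one agent, where no heavy edge exists. -/
theorem exists_welfareRatio_le_one [Infinite α] (A : OnlineAlgorithm α) (n : ℕ) :
    ∃ G : Game α, G.agents.card = n ∧ welfareRatio (expectedWelfare A G) (optWelfare G) ≤ 1 := by
  obtain ⟨N, hN⟩ := Infinite.exists_subset_card_eq α n
  refine ⟨⟨N, 0⟩, hN, ?_⟩
  have h1 : optWelfare (⟨N, 0⟩ : Game α) ≤ 0 :=
    (optWelfare_le_sum_posWeight _).trans (le_of_eq (by simp [posWeight]))
  unfold welfareRatio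
  split_ifs with hq hp
  · exact le_rfl
  · exact zero_le_one
  · refine (div_le_one_of_neg (lt_of_le_of_ne h1 hq)).2 ?_
    have h2 := socialWelfare_le_optWelfare (⟨N, 0⟩ : Game α) ⟨⊥, rfl⟩
    exact absurd (le_antisymm h1 (le_trans (by simp [socialWelfare, utility]) h2)) hq

theorem IsWaitingGreedy.exists_welfareRatio_le [Infinite α] {W : ℕ → OnlineAlgorithm α}
    (hW : IsWaitingGreedy W) {n : ℕ} (hn : 1 ≤ n) : ∃ G : Game α, G.agents.card = n ∧
      welfareRatio (expectedWelfare (iteratedDoubling W) G) (optWelfare G) ≤ 9 / n := by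
  rcases Nat.lt_or_ge n 2 with h | h
  · obtain ⟨G, hG, hle⟩ := exists_welfareRatio_le_one (iteratedDoubling W) n
    obtain rfl : n = 1 := by omega
    exact ⟨G, hG, hle.trans (by norm_num)⟩
  · exact hW.exists_welfareRatio_le_of_two_le h

end OnlineCoalition

theorem mainTheorem2 :
    ∃ c C : ℝ, 0 < c ∧ 0 < C ∧
      ∀ (α : Type*) [DecidableEq α] [Infinite α] (W : ℕ → OnlineCoalition.OnlineAlgorithm α),
        OnlineCoalition.IsWaitingGreedy W → ∀ n : ℕ, 1 ≤ n →
          ((c / n : ℝ) : EReal) ≤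
              OnlineCoalition.competitiveRatio (OnlineCoalition.iteratedDoubling W) n ∧
            OnlineCoalition.competitiveRatio (OnlineCoalition.iteratedDoubling W) n ≤
              ((C / n : ℝ) : EReal) := by
  refine ⟨1 / 16, 9, by norm_num, by norm_num, fun α _ _ W hW n hn => ⟨?_, ?_⟩⟩
  · refine le_iSup₂_of_le (1 / 16 / n : ℝ) (le_iInf₂ fun G hG => ?_) le_rfl
    have h := hW.le_welfareRatio G (hG.symm ▸ hn)
    rw [hG] at h
    have h' := (Rat.cast_le (K := ℝ)).2 h
    push_cast at h'
    rw [← div_div] at h'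
    exact EReal.coe_le_coe_iff.2 h'
  · obtain ⟨G, hG, hle⟩ := hW.exists_welfareRatio_le hn
    refine iSup₂_le fun c hc => hc.trans ((iInf₂_le G hG).trans (EReal.coe_le_coe_iff.2 ?_))
    have h := (Rat.cast_le (K := ℝ)).2 hle
    push_cast at h
    exact h
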